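/- **Setting.** Let $d\in\{2,3\}$, let $\Omega\subseteq\mathbb R^d$ be an open set with $\Omega=\operatorname{int}(\overline\Omega)$ (for instance a Lipschitz domain) and boundary $\Gamma=\partial\Omega$, and let $\mathcal T_\Omega$ be a (finite, conforming, simplicial) triangulation of $\overline\Omega$ with maximal mesh width $h=\max_{T\in\mathcal T_\Omega}\operatorname{diam}T$. The triangulation is quasi-uniform with parameter $\kappa>0$ if every element $T\in\mathcal T_\Omega$ contains a ball of radius $h/\kappa$. Let $\alpha\in L^\infty(\Omega)$ be a uniformly positive diffusion coefficient, with $\alpha\le A$ almost everywhere. For $k\ge1$ let $\mathbb V_h=\mathcal P_k(\mathcal T_\Omega)$ be the space of continuous functions on $\overline\Omega$ that are polynomials of degree at most $k$ on every element, with Lagrange nodes $z_a$ (the points whose barycentric coordinates in an element are multiples of $1/k$) and nodal basis $\varphi_a$, $\varphi_a(z_b)=\delta_{ab}$. Let $\mathbb M_h$ be a space of functions on $\Gamma$, spanned by $\mu_1,\dots,\mu_{N_\lambda}$, with $\mathbb V_h|_\Gamma=\mathbb M_h$, and let $\mathbb Q_h\subseteq L^2(\Gamma)$ be spanned by $\psi_1,\dots,\psi_{N_p}$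 (in particular, $\mathbb Q_h$ may be any conforming finite element space $\mathbb Q_h\subseteq H^1(\Gamma)$). Define $$(M_u)_{ab}=\int_\Omega\varphi_a\varphi_b\,dx,\quad (K_u)_{ab}=\int_\Omega\alpha\,\nabla\varphi_a\cdot\nabla\varphi_b\,dx,\quad (M_p)_{ij}=\int_\Gamma\psi_i\psi_j\,ds,$$ $$(B_u)_{ia}=\int_\Gamma\mu_i\,\varphi_a\,ds,\qquad (B_p)_{ij}=\int_\Gamma\mu_i\,\psi_j\,ds .$$ For a coefficient vector $u$ of a function in $\mathbb V_h$ let $u_2$ be the part of $u$ that belongs to the nodes on $\Gamma$, and let $M_{22}$, $K_{22}$ be the corresponding diagonal blocks of $M_u$, $K_u$. For a square matrix $M$ write $\|x\|_M^2=x^{\mathsf T}Mx$. **Lemma.** For all $k\ge 1$ and $\kappa>0$ there is a constant $c_M>0$, depending only on $k$ and $\kappa$, and for all $k\ge1$, $\kappa>0$ and $A>0$ there is a constant $c_K>0$, depending only on $k$, $\kappa$ and $A$, such that the following holds in the above setting for every $\Omega$, every triangulation $\mathcal T_\Omega$ that is quasi-uniform with parameter $\kappa$, every such $\alpha\le A$,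 and all such $\mathbb M_h$, $\mathbb Q_h$ (the constants do not depend on $h$): if the coefficient vectors $u\in\mathbb R^{N_u}$ and $p\in\mathbb R^{N_p}$ satisfy $B_uu=B_pp$, then $$\|u_2\|_{M_{22}}^2\le c_M\,h\,\|p\|_{M_p}^2\qquad\text{and}\qquad \|u_2\|_{K_{22}}^2\le c_K\,h^{-1}\,\|p\|_{M_p}^2 .$$ -/

import Mathlib

open MeasureTheory
open scoped Gradient

noncomputable section

namespace BulkSurface

/-- A conforming simplicial triangulation of the domain `Ω ⊆ ℝ^d`: a finite geometric simplicial
complex, all of whose maximal simplices are `d`-dimensional, with underlying set `closure Ω`.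
(Simplices are recorded by their vertex sets.) -/
structure Triangulation (d : ℕ) (Ω : Set (EuclideanSpace ℝ (Fin d))) extends
    Geometry.SimplicialComplex ℝ (EuclideanSpace ℝ (Fin d)) where
  finite_faces : faces.Finite
  pure : ∀ s ∈ faces, ∃ t ∈ faces, s ⊆ t ∧ t.card = d + 1
  closure_eq : closure Ω = toSimplicialComplex.space

namespace Triangulation

variable {d : ℕ} {Ω : Set (EuclideanSpace ℝ (Fin d))} (T : Triangulation d Ω)

/-- The elements of the triangulation, i.e. its `d`-dimensional simplices. -/
def cells : Set (Finset (EuclideanSpace ℝ (Fin d))) := {s | s ∈ T.faces ∧ s.card = d + 1}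

/-- The maximal mesh width `h`, the largest diameter of an element. -/
def meshWidth : ℝ :=
  sSup ((fun s : Finset (EuclideanSpace ℝ (Fin d)) =>
    Metric.diam (convexHull ℝ (s : Set (EuclideanSpace ℝ (Fin d))))) '' T.cells)

/-- Quasi-uniformity with parameter `κ`: every element contains a ball of radius `h / κ`. -/
def QuasiUniform (κ : ℝ) : Prop :=
  ∀ s ∈ T.cells, ∃ c : EuclideanSpace ℝ (Fin d),
    Metric.closedBall c (T.meshWidth / κ) ⊆ convexHull ℝ (s : Set (EuclideanSpace ℝ (Fin d)))

/-- The conforming finite element space `𝒫_k(T)`: continuous functions on `closure Ω` (extended by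
zero) whose restriction to each element is a polynomial of total degree at most `k`. -/
def lagrangeSpace (k : ℕ) : Submodule ℝ (EuclideanSpace ℝ (Fin d) → ℝ) where
  carrier := {v | ContinuousOn v (closure Ω) ∧ (∀ x ∉ closure Ω, v x = 0) ∧
    ∀ s ∈ T.cells, ∃ q : MvPolynomial (Fin d) ℝ, q.totalDegree ≤ k ∧
      ∀ x ∈ convexHull ℝ (s : Set (EuclideanSpace ℝ (Fin d))),
        v x = MvPolynomial.eval (fun i => x i) q}
  add_mem' := by
    rintro v w ⟨hv, hv0, hv'⟩ ⟨hw, hw0, hw'⟩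
    refine ⟨hv.add hw, fun x hx => by simp [hv0 x hx, hw0 x hx], fun s hs => ?_⟩
    obtain ⟨q, hq, hvq⟩ := hv' s hs
    obtain ⟨r, hr, hwr⟩ := hw' s hs
    exact ⟨q + r, (MvPolynomial.totalDegree_add q r).trans (max_le hq hr),
      fun x hx => by simp [hvq x hx, hwr x hx]⟩
  zero_mem' := ⟨continuousOn_const, fun _ _ => rfl, fun _ _ => ⟨0, by simp, fun _ _ => by simp⟩⟩
  smul_mem' := by
    rintro c v ⟨hv, hv0, hv'⟩
    refine ⟨hv.const_smul c, fun x hx => by simp [hv0 x hx], fun s hs => ?_⟩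
    obtain ⟨q, hq, hvq⟩ := hv' s hs
    exact ⟨c • q, (MvPolynomial.totalDegree_smul_le c q).trans hq,
      fun x hx => by simp [hvq x hx, MvPolynomial.smul_eval]⟩

/-- `w` is a system of barycentric coordinates of the point `x` with respect to the vertices of the
triangulation, supported on the vertices of one simplex. -/
def IsBary (x : EuclideanSpace ℝ (Fin d)) (w : EuclideanSpace ℝ (Fin d) →₀ ℝ) : Prop :=
  (∀ v, 0 ≤ w v) ∧ w.support ∈ T.faces ∧ (w.sum fun _ c => c) = 1 ∧ (w.sum fun v c => c • v) = x

open Classical in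
/-- The barycentric coordinates of `x` (unique for `x ∈ closure Ω`), and zero off `closure Ω`. For
fixed `v`, the map `x ↦ T.bary x v` is the piecewise linear hat function of the vertex `v`. -/
def bary (x : EuclideanSpace ℝ (Fin d)) : EuclideanSpace ℝ (Fin d) →₀ ℝ :=
  if h : ∃ w, T.IsBary x w then h.choose else 0

/-- The Lagrange nodes of degree `k`, as multi-indices `a` with `∑ a_v = k` on the vertices of a
simplex; `a` stands for the point with barycentric coordinates `a_v / k`. -/
def Node (k : ℕ) : Type :=
  {a : EuclideanSpace ℝ (Fin d) →₀ ℕ // a.support ∈ T.faces ∧ (a.sum fun _ m => m) = k}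

instance (k : ℕ) : Finite (T.Node k) := by
  classical
  refine Set.Finite.to_subtype (s := {a : EuclideanSpace ℝ (Fin d) →₀ ℕ |
    a.support ∈ T.faces ∧ (a.sum fun _ m => m) = k}) ?_
  refine Set.Finite.subset
    (T.finite_faces.toFinset.biUnion fun s => Finset.finsuppAntidiag s k).finite_toSet ?_
  rintro a ⟨ha, hk⟩
  simp only [Finset.coe_biUnion, Set.mem_iUnion, Finset.mem_coe, Finset.mem_finsuppAntidiag]
  exact ⟨a.support, by simpa using ha, hk, subset_rfl⟩

instance (k : ℕ) : Fintype (T.Node k) := Fintype.ofFinite _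

variable {T} in
/-- The position of a Lagrange node. -/
def Node.point {k : ℕ} (a : T.Node k) : EuclideanSpace ℝ (Fin d) :=
  a.1.sum fun v m => ((m : ℝ) / k) • v

/-- The Lagrange nodes on the boundary `Γ = ∂Ω`. -/
def BoundaryNode (k : ℕ) : Type := {a : T.Node k // a.point ∈ frontier Ω}

instance (k : ℕ) : Fintype (T.BoundaryNode k) :=
  @Fintype.ofFinite _ (inferInstanceAs (Finite {a : T.Node k // a.point ∈ frontier Ω}))

/-- The Lagrange nodal basis function of `𝒫_k(T)` belonging to the node `a`,
`∏_v (1 / a_v!) ∏_{j < a_v} (k λ_v - j)` with the barycentric coordinates `λ_v`. -/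
def nodalBasis (k : ℕ) (a : T.Node k) (x : EuclideanSpace ℝ (Fin d)) : ℝ :=
  a.1.prod fun v m => ∏ j ∈ Finset.range m, ((k : ℝ) * T.bary x v - j) / (j + 1)

section facts
variable {T}

/-- Barycentric coordinates are unique. -/
theorem IsBary.unique {x : EuclideanSpace ℝ (Fin d)} {w w' : EuclideanSpace ℝ (Fin d) →₀ ℝ}
    (hw : T.IsBary x w) (hw' : T.IsBary x w') : w = w' := by
  classical
  obtain ⟨h0, hs, h1, hx⟩ := hw
  obtain ⟨h0', hs', h1', hx'⟩ := hw'
  have m : ∀ {w : EuclideanSpace ℝ (Fin d) →₀ ℝ}, (∀ v, 0 ≤ w v) → (w.sum fun _ c => c) = 1 →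
      (w.sum fun v c => c • v) = x →
      x ∈ convexHull ℝ (w.support : Set (EuclideanSpace ℝ (Fin d))) := by
    intro w h0 h1 hx
    rw [Finset.mem_convexHull']
    exact ⟨w, fun v _ => h0 v, h1, hx⟩
  have key := T.inter_subset_convexHull hs hs' ⟨m h0 h1 hx, m h0' h1' hx'⟩
  rw [← Finset.coe_inter, Finset.mem_convexHull'] at key
  obtain ⟨y, hy0, hy1, hyx⟩ := key
  have gen : ∀ {w : EuclideanSpace ℝ (Fin d) →₀ ℝ} (t : Finset (EuclideanSpace ℝ (Fin d))),
      w.support ∈ T.faces → t ⊆ w.support → (w.sum fun _ c => c) = 1 →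
      (w.sum fun v c => c • v) = x → (∑ v ∈ t, y v = 1) → (∑ v ∈ t, y v • v = x) →
      ∀ v, w v = if v ∈ t then y v else 0 := by
    intro w t hs hts h1 hx hy1 hyx v
    by_cases hv : v ∈ w.support
    · have ind := T.indep hs
      have := (affineIndependent_iff.1 ind) Finset.univ
        (fun v => w v - if (v : EuclideanSpace ℝ (Fin d)) ∈ t then y v else 0) ?_ ?_ ⟨v, hv⟩
        (Finset.mem_univ _)
      · exact sub_eq_zero.1 this
      · rw [Finset.univ_eq_attach, Finset.sum_attach w.support
          (fun v => w v - if v ∈ t then y v else 0), Finset.sum_sub_distrib,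
          Finset.sum_ite_mem, Finset.inter_eq_right.2 hts, hy1, ← h1]
        simp [Finsupp.sum]
      · rw [Finset.univ_eq_attach, Finset.sum_attach w.support
          (fun v => (w v - if v ∈ t then y v else 0) • v)]
        simp only [sub_smul, ite_smul, zero_smul]
        rw [Finset.sum_sub_distrib, Finset.sum_ite_mem, Finset.inter_eq_right.2 hts, hyx, ← hx]
        simp [Finsupp.sum]
    · rw [if_neg (fun h => hv (hts h)), Finsupp.notMem_support_iff.1 hv]
  ext v
  rw [gen _ hs Finset.inter_subset_left h1 hx hy1 hyx,
    gen _ hs' Finset.inter_subset_right h1' hx' hy1 hyx]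

theorem IsBary.bary_eq {x : EuclideanSpace ℝ (Fin d)} {w : EuclideanSpace ℝ (Fin d) →₀ ℝ}
    (hw : T.IsBary x w) : T.bary x = w := by
  have h : ∃ w, T.IsBary x w := ⟨w, hw⟩
  rw [bary, dif_pos h]
  exact h.choose_spec.unique hw

theorem Node.isBary {k : ℕ} (hk : 1 ≤ k) (a : T.Node k) :
    T.IsBary a.point (a.1.mapRange (fun m : ℕ => (m : ℝ) / k) (by simp)) := by
  have hk' : (k : ℝ) ≠ 0 := by positivity
  have hsupp : (a.1.mapRange (fun m : ℕ => (m : ℝ) / k) (by simp)).support = a.1.support := by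
    ext v; simp [hk']
  refine ⟨fun v => by rw [Finsupp.mapRange_apply]; positivity, by rw [hsupp]; exact a.2.1, ?_, ?_⟩
  · rw [Finsupp.sum_mapRange_index (by simp), Finsupp.sum, ← Finset.sum_div, ← Nat.cast_sum,
      div_eq_one_iff_eq hk']
    exact_mod_cast a.2.2
  · rw [Finsupp.sum_mapRange_index (by simp)]; rfl

/-- The nodal basis functions satisfy `φ_a(z_b) = δ_{ab}`. -/
theorem nodalBasis_point {k : ℕ} (hk : 1 ≤ k) (a b : T.Node k) [Decidable (a = b)] :
    T.nodalBasis k a b.point = if a = b then 1 else 0 := by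
  have hk' : (k : ℝ) ≠ 0 := by positivity
  have hval : ∀ v, (k : ℝ) * T.bary b.point v = b.1 v := fun v => by
    rw [(b.isBary hk).bary_eq]; simp; field_simp
  unfold nodalBasis
  simp only [hval]
  split_ifs with hab
  · subst hab
    refine Finset.prod_eq_one fun v _ => ?_
    change ∏ j ∈ Finset.range (a.1 v), ((a.1 v : ℝ) - j) / ((j : ℝ) + 1) = 1
    rw [Finset.prod_div_distrib]
    have h1 : ∏ j ∈ Finset.range (a.1 v), ((a.1 v : ℝ) - j) = ((a.1 v).factorial : ℝ) := by
      rw [← Nat.descFactorial_self, Nat.descFactorial_eq_prod_range, Nat.cast_prod]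
      refine Finset.prod_congr rfl fun j hj => ?_
      rw [Nat.cast_sub (Finset.mem_range.1 hj).le]
    have h2 : ∏ j ∈ Finset.range (a.1 v), ((j : ℝ) + 1) = ((a.1 v).factorial : ℝ) := by
      rw [← Finset.prod_range_add_one_eq_factorial]; push_cast; rfl
    rw [h1, h2, div_self (by positivity)]
  · have : ∃ v, b.1 v < a.1 v := by
      by_contra! hle
      apply hab
      have hle' : a.1 ≤ b.1 := hle
      have hadd : a.1 + (b.1 - a.1) = b.1 := add_tsub_cancel_of_le hle'
      have hs : (b.1.sum fun _ m => m) = (a.1.sum fun _ m => m) +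
          ((b.1 - a.1).sum fun _ m => m) := by
        conv_lhs => rw [← hadd]
        exact Finsupp.sum_add_index' (fun _ => rfl) (fun _ _ _ => rfl)
      rw [a.2.2, b.2.2] at hs
      have hz : ((b.1 - a.1).sum fun _ m => m) = 0 := by omega
      have hz' : b.1 - a.1 = 0 := by
        ext v
        by_contra hv
        have := (Finset.sum_eq_zero_iff.1 hz) v (Finsupp.mem_support_iff.2 hv)
        exact hv this
      apply Subtype.ext
      rw [← hadd, hz', add_zero]
    obtain ⟨v, hv⟩ := this
    refine Finset.prod_eq_zero (i := v) (Finsupp.mem_support_iff.2 (by omega)) ?_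
    refine Finset.prod_eq_zero (i := b.1 v) (Finset.mem_range.2 hv) (by simp)

/-- On an element, the barycentric coordinates are affine functions. -/
theorem exists_affine {s : Finset (EuclideanSpace ℝ (Fin d))} (hs : s ∈ T.cells)
    (v : EuclideanSpace ℝ (Fin d)) :
    ∃ q : MvPolynomial (Fin d) ℝ, q.totalDegree ≤ 1 ∧
      ∀ x ∈ convexHull ℝ (s : Set (EuclideanSpace ℝ (Fin d))),
        T.bary x v = MvPolynomial.eval (fun i => x i) q := by
  classical
  have hw : ∀ x ∈ convexHull ℝ (s : Set (EuclideanSpace ℝ (Fin d))),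
      ∃ w : EuclideanSpace ℝ (Fin d) → ℝ, ∑ y ∈ s, w y = 1 ∧ ∑ y ∈ s, w y • y = x ∧
        ∀ v, T.bary x v = if v ∈ s then w v else 0 := by
    intro x hx
    obtain ⟨w, h0, h1, hx⟩ := Finset.mem_convexHull'.1 hx
    let f : EuclideanSpace ℝ (Fin d) →₀ ℝ :=
      Finsupp.onFinset s (fun v => if v ∈ s then w v else 0) (by
        intro v hv; by_contra h; exact hv (if_neg h))
    have hfs : f.support ⊆ s := Finsupp.support_onFinset_subset
    have hf1 : (f.sum fun _ c => c) = 1 := by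
      rw [Finsupp.sum_of_support_subset f hfs _ (by simp), ← h1]
      exact Finset.sum_congr rfl fun v hv => if_pos hv
    have hfx : (f.sum fun v c => c • v) = x := by
      rw [Finsupp.sum_of_support_subset f hfs _ (by simp), ← hx]
      exact Finset.sum_congr rfl fun v hv => by
        change (if v ∈ s then w v else 0) • v = _
        rw [if_pos hv]
    have hne : f.support.Nonempty := by
      rw [Finset.nonempty_iff_ne_empty]
      intro h
      rw [Finsupp.support_eq_empty.1 h] at hf1
      simp at hf1
    have hb : T.IsBary x f := by
      refine ⟨fun v => ?_, T.down_closed hs.1 hfs hne, hf1, hfx⟩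
      change 0 ≤ if v ∈ s then w v else 0
      split_ifs with h
      · exact h0 v h
      · exact le_rfl
    exact ⟨w, h1, hx, fun v => by rw [hb.bary_eq]; rfl⟩
  by_cases hv : v ∈ s
  · have htop : affineSpan ℝ (Set.range ((↑) : s → EuclideanSpace ℝ (Fin d))) = ⊤ := by
      rw [(T.indep hs.1).affineSpan_eq_top_iff_card_eq_finrank_add_one]
      simp [hs.2]
    let b : AffineBasis s ℝ (EuclideanSpace ℝ (Fin d)) := ⟨(↑), T.indep hs.1, htop⟩
    let f := b.coord ⟨v, hv⟩
    have hf : ∀ x, f x = ∑ i, x i * f.linear (EuclideanSpace.single i 1) + f 0 := by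
      intro x
      have h1 : f x = f.linear x + f 0 := by
        have := f.map_vadd 0 x
        simpa using this
      rw [h1]
      congr 1
      have h2 : x = ∑ i, x i • EuclideanSpace.single i (1 : ℝ) := by
        ext j; simp [Finset.sum_apply, Pi.single_apply]
      conv_lhs => rw [h2]
      simp
    refine ⟨∑ i, MvPolynomial.X i * MvPolynomial.C (f.linear (EuclideanSpace.single i 1)) +
      MvPolynomial.C (f 0), ?_, ?_⟩
    · refine (MvPolynomial.totalDegree_add _ _).trans (max_le ?_ (by simp))
      refine MvPolynomial.totalDegree_finsetSum_le fun i _ => ?_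
      refine (MvPolynomial.totalDegree_mul _ _).trans ?_
      simp
    · intro x hx
      obtain ⟨w, h1, hx', hb⟩ := hw x hx
      have : f x = w v := by
        have hc := b.coord_apply_combination_of_mem (i := ⟨v, hv⟩) (s := Finset.univ)
          (Finset.mem_univ _) (w := fun y => w y)
          (by rw [Finset.univ_eq_attach, Finset.sum_attach s w, h1])
        have h3 : Finset.univ.affineCombination ℝ b (fun y : s => w y) = x := by
          rw [Finset.affineCombination_eq_linear_combination _ _ _
            (by rw [Finset.univ_eq_attach, Finset.sum_attach s w, h1]), ← hx',
            Finset.univ_eq_attach]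
          exact Finset.sum_attach s (fun y => w y • y)
        rw [h3] at hc
        exact hc
      rw [hb, if_pos hv, ← this, hf]
      simp
  · exact ⟨0, by simp, fun x hx => by
      obtain ⟨w, _, _, hb⟩ := hw x hx
      rw [hb, if_neg hv]; simp⟩

theorem closure_eq_cells :
    closure Ω = ⋃ s : T.cells, convexHull ℝ (s.1 : Set (EuclideanSpace ℝ (Fin d))) := by
  rw [T.closure_eq]
  ext x
  rw [Geometry.SimplicialComplex.mem_space_iff, Set.mem_iUnion]
  constructor
  · rintro ⟨s, hs, hx⟩
    obtain ⟨t, ht, hst, hc⟩ := T.pure s hs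
    exact ⟨⟨t, ht, hc⟩, convexHull_mono (Finset.coe_subset.2 hst) hx⟩
  · rintro ⟨s, hx⟩
    exact ⟨s.1, s.2.1, hx⟩

/-- The nodal basis functions belong to `𝒫_k(T)`. -/
theorem nodalBasis_mem {k : ℕ} (a : T.Node k) : T.nodalBasis k a ∈ T.lagrangeSpace k := by
  classical
  have hpoly : ∀ s ∈ T.cells, ∃ q : MvPolynomial (Fin d) ℝ, q.totalDegree ≤ k ∧
      ∀ x ∈ convexHull ℝ (s : Set (EuclideanSpace ℝ (Fin d))),
        T.nodalBasis k a x = MvPolynomial.eval (fun i => x i) q := by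
    intro s hs
    choose q hq hqx using fun v => exists_affine hs v
    refine ⟨∏ v ∈ a.1.support, ∏ j ∈ Finset.range (a.1 v),
      MvPolynomial.C (((j : ℝ) + 1)⁻¹) *
        (MvPolynomial.C (k : ℝ) * q v + MvPolynomial.C (-(j : ℝ))), ?_, ?_⟩
    · refine (MvPolynomial.totalDegree_finsetProd _ _).trans ?_
      refine le_trans (Finset.sum_le_sum fun v _ => ?_) (le_of_eq a.2.2)
      refine (MvPolynomial.totalDegree_finsetProd _ _).trans ?_
      refine (Finset.sum_le_card_nsmul _ _ 1 fun j _ => ?_).trans (by simp)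
      refine (MvPolynomial.totalDegree_mul _ _).trans ?_
      rw [MvPolynomial.totalDegree_C, zero_add]
      refine (MvPolynomial.totalDegree_add _ _).trans (max_le ?_
        (by rw [MvPolynomial.totalDegree_C]; exact zero_le_one))
      refine (MvPolynomial.totalDegree_mul _ _).trans ?_
      rw [MvPolynomial.totalDegree_C, zero_add]
      exact hq v
    · intro x hx
      simp only [map_prod, map_mul, map_add, MvPolynomial.eval_C, ← hqx _ x hx]
      unfold nodalBasis
      refine Finset.prod_congr rfl fun v _ => Finset.prod_congr rfl fun j _ => ?_
      rw [div_eq_inv_mul, sub_eq_add_neg]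
  refine ⟨?_, ?_, hpoly⟩
  · have hfin : T.cells.Finite := T.finite_faces.subset fun s hs => hs.1
    have : Finite T.cells := hfin
    rw [T.closure_eq_cells]
    refine LocallyFinite.continuousOn_iUnion (locallyFinite_of_finite _) (fun s => ?_) fun s => ?_
    · exact (s.1.finite_toSet.isCompact_convexHull ℝ).isClosed
    · obtain ⟨q, _, hqx⟩ := hpoly s.1 s.2
      refine ContinuousOn.congr ?_ hqx
      refine Continuous.continuousOn ?_
      exact (MvPolynomial.continuous_eval q).comp (by fun_prop)
  · intro x hx
    have hb : T.bary x = 0 := by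
      rw [bary, dif_neg]
      rintro ⟨w, h0, hs, h1, hxw⟩
      apply hx
      rw [T.closure_eq, Geometry.SimplicialComplex.mem_space_iff]
      exact ⟨w.support, hs, Finset.mem_convexHull'.2 ⟨w, fun v _ => h0 v, h1, hxw⟩⟩
    obtain ⟨v, hv⟩ := T.nonempty_of_mem_faces a.2.1
    refine Finset.prod_eq_zero hv ?_
    refine Finset.prod_eq_zero (i := 0)
      (Finset.mem_range.2 (Nat.pos_of_ne_zero (Finsupp.mem_support_iff.1 hv))) ?_
    simp [hb]

end facts

/-- The mass matrix `M_u` of `𝒫_k(T)` in `L²(Ω)`. -/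
def massMatrix (k : ℕ) : Matrix (T.Node k) (T.Node k) ℝ :=
  Matrix.of fun a b => ∫ x in Ω, T.nodalBasis k a x * T.nodalBasis k b x

/-- The stiffness matrix `K_u` of `𝒫_k(T)` for the diffusion coefficient `α`. -/
def stiffnessMatrix (k : ℕ) (α : EuclideanSpace ℝ (Fin d) → ℝ) :
    Matrix (T.Node k) (T.Node k) ℝ :=
  Matrix.of fun a b => ∫ x in Ω, α x * inner ℝ (∇ (T.nodalBasis k a) x) (∇ (T.nodalBasis k b) x)

variable {T} in
/-- The boundary part `u_2` of a coefficient vector `u = (u_1, u_2)`. -/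
def boundaryPart {k : ℕ} (u : T.Node k → ℝ) : T.BoundaryNode k → ℝ := fun a => u a.1

variable {T} in
/-- The block `A_22` of a matrix `A` with respect to the decomposition `u = (u_1, u_2)`. -/
def boundaryBlock {k : ℕ} (A : Matrix (T.Node k) (T.Node k) ℝ) :
    Matrix (T.BoundaryNode k) (T.BoundaryNode k) ℝ :=
  A.submatrix (fun a => a.1) (fun a => a.1)

end Triangulation

/-- The surface measure on `Γ = ∂Ω`. -/
def surfaceMeasure {d : ℕ} (Ω : Set (EuclideanSpace ℝ (Fin d))) :
    Measure (EuclideanSpace ℝ (Fin d)) :=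
  (Measure.euclideanHausdorffMeasure (d - 1)).restrict (frontier Ω)

/-- The matrix of the `L²(Γ)` inner products of two families of functions. -/
def surfaceMatrix {d : ℕ} (Ω : Set (EuclideanSpace ℝ (Fin d))) {ι ι' : Type*}
    (f : ι → EuclideanSpace ℝ (Fin d) → ℝ) (g : ι' → EuclideanSpace ℝ (Fin d) → ℝ) :
    Matrix ι ι' ℝ :=
  Matrix.of fun i j => ∫ x, f i x * g j x ∂(surfaceMeasure Ω)

/-- Restriction of functions to `Γ = ∂Ω`. -/
def traceMap {d : ℕ} (Ω : Set (EuclideanSpace ℝ (Fin d))) :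
    (EuclideanSpace ℝ (Fin d) → ℝ) →ₗ[ℝ] (frontier Ω → ℝ) :=
  LinearMap.funLeft ℝ ℝ (Subtype.val : frontier Ω → EuclideanSpace ℝ (Fin d))

/-- The squared norm `‖x‖_M² = xᵀ M x` of a coefficient vector. -/
def normSq {ι : Type*} [Fintype ι] (M : Matrix ι ι ℝ) (x : ι → ℝ) : ℝ := x ⬝ᵥ M.mulVec x

end BulkSurface

end

/-!
Let `v` be the finite element function with coefficient vector `u`. Since the traces of the finite
element space lie in the span of the `μ_i`, the equation `B_u u = B_p p` says that the trace of `v`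
is the `L²(Γ)`-projection of `∑ p_j ψ_j`, so that `‖v‖_{L²(Γ)} ≤ ‖p‖_{M_p}`.

It remains to bound the boundary coefficients of `v` by its trace. Since `Ω` is the interior of its
closure, `Γ` is a union of `(d - 1)`-dimensional faces of the triangulation. On each of them `v` is
the pull-back of a polynomial on the reference simplex, on which all norms are equivalent. A ball of
radius `h / κ` in an adjacent element makes the barycentric coordinates Lipschitz with constant
`κ / h`, which controls the parametrization of the face without any regularity of its shape and
gives `|u_2|² ≤ C h^{1 - d} ‖v‖²_{L²(Γ)}`. Finally, the largest eigenvalues of `M_u` and `K_u` are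
of order `h^d` and `A h^{d - 2}`: the basis functions and their gradients are bounded by multiples
of `1` and `κ / h`, each is supported in a ball of radius `h`, and boundedly many of them overlap.
-/

noncomputable section

namespace BulkSurface

open Filter Topology

section AffineGeometry

theorem abs_affineMap_sub_le_div {E : Type*} [NormedAddCommGroup E] [NormedSpace ℝ E]
    (f : E →ᵃ[ℝ] ℝ) {c : E} {r : ℝ} (hr : 0 < r)
    (hf : ∀ x ∈ Metric.closedBall c r, f x ∈ Set.Icc (0 : ℝ) 1) (x y : E) :
    |f x - f y| ≤ ‖x - y‖ / r := by
  rcases eq_or_ne x y with rfl | hxy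
  · simp
  have hn : 0 < ‖x - y‖ := norm_pos_iff.2 (sub_ne_zero.2 hxy)
  set z : E := c + (r / ‖x - y‖) • (x - y) with hz
  have hfz : f z - f c = r / ‖x - y‖ * (f x - f y) := by
    have hlin : ∀ p q, f p - f q = f.linear (p - q) := fun p q => (f.linearMap_vsub p q).symm
    rw [hlin, hlin, hz, add_sub_cancel_left, map_smul, smul_eq_mul]
  have hzc : z ∈ Metric.closedBall c r := by
    rw [mem_closedBall_iff_norm, hz, add_sub_cancel_left, norm_smul, Real.norm_eq_abs,
      abs_of_pos (by positivity), div_mul_cancel₀ _ hn.ne']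
  have hle : |f z - f c| ≤ 1 := by
    have h0 := hf z hzc
    have h1 := hf c (Metric.mem_closedBall_self hr.le)
    exact abs_le.2 ⟨by linarith [h0.1, h1.2], by linarith [h0.2, h1.1]⟩
  rw [hfz, abs_mul, abs_of_pos (by positivity), div_mul_eq_mul_div, div_le_one hn] at hle
  rwa [le_div_iff₀' hr]

theorem eventually_add_mem_convexHull_of_coord_eq_zero {ι E : Type*} [Finite ι]
    [NormedAddCommGroup E] [NormedSpace ℝ E] (b : AffineBasis ι ℝ E) {x y : E}
    (hx : x ∈ convexHull ℝ (Set.range b)) (hxy : ∀ i, b.coord i x = 0 → b.coord i y = 0) :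
    ∀ᶠ δ in 𝓝 (0 : E), y + δ ∈ convexHull ℝ (Set.range b) →
      x + δ ∈ convexHull ℝ (Set.range b) := by
  have := b.finiteDimensional
  simp only [b.convexHull_eq_nonneg_coord, Set.mem_ofPred_eq] at hx ⊢
  suffices ∀ i, ∀ᶠ δ in 𝓝 (0 : E), 0 ≤ b.coord i (y + δ) → 0 ≤ b.coord i (x + δ) from
    (eventually_all.2 this).mono fun δ hδ hy i => hδ i (hy i)
  intro i
  rcases (hx i).eq_or_lt with hi | hi
  · refine Eventually.of_forall fun δ hδ => ?_
    have hcoord : ∀ z, b.coord i (z + δ) = (b.coord i).linear δ + b.coord i z := fun z => by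
      rw [add_comm]; exact (b.coord i).map_vadd z δ
    rw [hcoord, hxy i hi.symm] at hδ
    rwa [hcoord, ← hi]
  · have hcont : Continuous fun δ => b.coord i (x + δ) :=
      (continuous_barycentric_coord b i).comp (continuous_const_add x)
    have hlim : Tendsto (fun δ => b.coord i (x + δ)) (𝓝 0) (𝓝 (b.coord i x)) := by
      simpa using hcont.tendsto 0
    filter_upwards [hlim.eventually (lt_mem_nhds hi)] with δ hδ _ using hδ.le

theorem affineSpan_ne_top_of_card_le_finrank {k V : Type*} [DivisionRing k] [AddCommGroup V]
    [Module k V] {s : Finset V} (hs : s.card ≤ Module.finrank k V) :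
    affineSpan k (s : Set V) ≠ ⊤ := by
  intro h
  have hne : Nonempty s := by
    rw [Finset.nonempty_coe_sort, ← Finset.coe_nonempty, ← affineSpan_nonempty k, h]
    exact ⟨0, trivial⟩
  have hrank := finrank_vectorSpan_range_add_one_le k ((↑) : s → V)
  rw [Subtype.range_coe_subtype, Finset.setOfPred_mem, ← direction_affineSpan, h,
    AffineSubspace.direction_top, finrank_top, Fintype.card_coe] at hrank
  omega

theorem dense_setOf_forall_notMem_affineSubspace {ι E : Type*} [Countable ι]
    [NormedAddCommGroup E] [NormedSpace ℝ E] [FiniteDimensional ℝ E] {S : ι → AffineSubspace ℝ E}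
    (hS : ∀ i, S i ≠ ⊤) : Dense {x | ∀ i, x ∉ S i} := by
  borelize E
  refine Measure.dense_of_ae (μ := Measure.addHaar) (ae_all_iff.2 fun i => ?_)
  exact measure_eq_zero_iff_ae_notMem.1 (Measure.addHaar_affineSubspace _ _ (hS i))

theorem inter_frontier_nonempty {X : Type*} [TopologicalSpace X] {s u : Set X}
    (hs : IsPreconnected s) (hsu : (s ∩ u).Nonempty) (hsu' : (s \ u).Nonempty) :
    (s ∩ frontier u).Nonempty := by
  by_contra! h
  have hcover : s ⊆ interior u ∪ (closure u)ᶜ := fun x hx => by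
    by_contra hx'
    rw [Set.mem_union, not_or, Set.notMem_compl_iff] at hx'
    exact h.subset ⟨hx, hx'.2, hx'.1⟩
  obtain ⟨x, -, hx, hx'⟩ := hs _ _ isOpen_interior isClosed_closure.isOpen_compl hcover
    (hsu.imp fun x hx => ⟨hx.1, (hcover hx.1).resolve_right fun h => h (subset_closure hx.2)⟩)
    (hsu'.imp fun x hx => ⟨hx.1, (hcover hx.1).resolve_left fun h => hx.2 (interior_subset h)⟩)
  exact hx' (subset_closure (interior_subset hx))

end AffineGeometry

namespace Triangulation

variable {d : ℕ} {Ω : Set (EuclideanSpace ℝ (Fin d))} {T : Triangulation d Ω}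
  {s t : Finset (EuclideanSpace ℝ (Fin d))} {v x y z : EuclideanSpace ℝ (Fin d)}

local notation "𝔼" => EuclideanSpace ℝ (Fin d)

theorem finite_cells (T : Triangulation d Ω) : T.cells.Finite :=
  T.finite_faces.subset fun _ hs => hs.1

theorem exists_cell_superset (ht : t ∈ T.faces) : ∃ s ∈ T.cells, t ⊆ s := by
  obtain ⟨s, hs, hts, hcard⟩ := T.pure t ht
  exact ⟨s, ⟨hs, hcard⟩, hts⟩

theorem exists_cell_of_mem_closure (T : Triangulation d Ω) (hx : x ∈ closure Ω) :
    ∃ s ∈ T.cells, x ∈ convexHull ℝ (s : Set 𝔼) := by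
  simpa [T.closure_eq_cells] using hx

theorem convexHull_face_subset (ht : t ∈ T.faces) : convexHull ℝ (t : Set 𝔼) ⊆ closure Ω := by
  rw [T.closure_eq]
  exact Geometry.SimplicialComplex.convexHull_subset_space ht

theorem isClosed_convexHull (s : Finset 𝔼) : IsClosed (convexHull ℝ (s : Set 𝔼)) :=
  (s.finite_toSet.isCompact_convexHull ℝ).isClosed

theorem isCompact_closure (T : Triangulation d Ω) : IsCompact (closure Ω) := by
  have : Finite T.cells := T.finite_cells
  rw [T.closure_eq_cells]
  exact isCompact_iUnion fun s => s.1.finite_toSet.isCompact_convexHull ℝ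

/-- The vertices of an element as an affine basis of `ℝ^d`; its coordinates extend the barycentric
coordinates on the element to affine functions on the whole space. -/
def cellBasis (hs : s ∈ T.cells) : AffineBasis s ℝ 𝔼 :=
  ⟨(↑), T.indep hs.1, by
    rw [(T.indep hs.1).affineSpan_eq_top_iff_card_eq_finrank_add_one]
    simp [hs.2]⟩

theorem range_cellBasis (hs : s ∈ T.cells) : Set.range (cellBasis hs) = (s : Set 𝔼) :=
  Subtype.range_coe

theorem mem_convexHull_cell_iff (hs : s ∈ T.cells) :
    x ∈ convexHull ℝ (s : Set 𝔼) ↔ ∀ v, 0 ≤ (cellBasis hs).coord v x := by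
  rw [← range_cellBasis hs, (cellBasis hs).convexHull_eq_nonneg_coord, Set.mem_ofPred_eq]

theorem mem_interior_convexHull_cell_iff (hs : s ∈ T.cells) :
    x ∈ interior (convexHull ℝ (s : Set 𝔼)) ↔ ∀ v, 0 < (cellBasis hs).coord v x := by
  rw [← range_cellBasis hs, (cellBasis hs).interior_convexHull, Set.mem_ofPred_eq]

theorem IsBary.mem_convexHull {w : 𝔼 →₀ ℝ} (hw : T.IsBary x w) (ht : w.support ⊆ t) :
    x ∈ convexHull ℝ (t : Set 𝔼) :=
  convexHull_mono (Finset.coe_subset.2 ht)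
    (Finset.mem_convexHull'.2 ⟨w, fun v _ => hw.1 v, hw.2.2.1, hw.2.2.2⟩)

theorem isBary_indicator (ht : t ∈ T.faces) {w : t → ℝ} (hw : 0 ≤ w) (hw1 : ∑ v, w v = 1) :
    T.IsBary (∑ v, w v • (v : 𝔼)) (Finsupp.indicator t fun v hv => w ⟨v, hv⟩) := by
  set f : 𝔼 →₀ ℝ := Finsupp.indicator t fun v hv => w ⟨v, hv⟩
  have hf1 : (f.sum fun _ c => c) = 1 := by
    rw [Finsupp.sum_indicator_index_eq_sum_attach _ fun _ _ => rfl, ← hw1]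
    rfl
  refine ⟨fun v => ?_, T.down_closed ht (Finsupp.support_indicator_subset _ _) ?_, hf1, ?_⟩
  · rw [Finsupp.indicator_apply]
    split_ifs with hv
    exacts [hw _, le_rfl]
  · by_contra h
    rw [Finset.not_nonempty_iff_eq_empty, Finsupp.support_eq_empty] at h
    simp [h] at hf1
  · exact Finsupp.sum_indicator_index_eq_sum_attach _ fun _ _ => zero_smul _ _

theorem bary_support_subset (ht : t ∈ T.faces) (hx : x ∈ convexHull ℝ (t : Set 𝔼)) :
    (T.bary x).support ⊆ t := by
  obtain ⟨w, hw, hw1, rfl⟩ := Finset.mem_convexHull'.1 hx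
  rw [← Finset.sum_coe_sort] at hw1
  rw [← Finset.sum_coe_sort, (isBary_indicator ht (fun v => hw v v.2) hw1).bary_eq]
  exact Finsupp.support_indicator_subset _ _

theorem isBary_bary (hx : x ∈ closure Ω) : T.IsBary x (T.bary x) := by
  obtain ⟨s, hs, hxs⟩ := T.exists_cell_of_mem_closure hx
  obtain ⟨w, hw, hw1, rfl⟩ := Finset.mem_convexHull'.1 hxs
  rw [← Finset.sum_coe_sort] at hw1 ⊢
  have h := isBary_indicator hs.1 (fun v => hw v v.2) hw1
  rwa [h.bary_eq]

theorem mem_convexHull_iff_bary_support (hx : x ∈ closure Ω) (ht : t ∈ T.faces) :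
    x ∈ convexHull ℝ (t : Set 𝔼) ↔ (T.bary x).support ⊆ t :=
  ⟨bary_support_subset ht, (isBary_bary hx).mem_convexHull⟩

theorem bary_eq_coord (hs : s ∈ T.cells) (hx : x ∈ convexHull ℝ (s : Set 𝔼)) (v : s) :
    T.bary x v = (cellBasis hs).coord v x := by
  have h := isBary_indicator hs.1 ((mem_convexHull_cell_iff hs).1 hx)
    ((cellBasis hs).sum_coord_apply_eq_one x)
  have hsum : ∑ v, (cellBasis hs).coord v x • (v : 𝔼) = x :=
    (cellBasis hs).linear_combination_coord_eq_self x
  rw [hsum] at h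
  rw [h.bary_eq, Finsupp.indicator_of_mem v.2]

theorem bary_eq_zero_of_notMem (ht : t ∈ T.faces) (hx : x ∈ convexHull ℝ (t : Set 𝔼))
    (hv : v ∉ t) : T.bary x v = 0 :=
  Finsupp.notMem_support_iff.1 fun h => hv (bary_support_subset ht hx h)

theorem bary_eq_zero_of_notMem_closure (hx : x ∉ closure Ω) : T.bary x = 0 :=
  dif_neg fun ⟨_, hw⟩ => hx (convexHull_face_subset hw.2.1 (hw.mem_convexHull subset_rfl))

theorem bary_mem_Icc (T : Triangulation d Ω) (x v : 𝔼) : T.bary x v ∈ Set.Icc (0 : ℝ) 1 := by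
  by_cases hx : x ∈ closure Ω
  · obtain ⟨h0, -, h1, -⟩ := isBary_bary (T := T) hx
    refine ⟨h0 v, ?_⟩
    by_cases hv : v ∈ (T.bary x).support
    · exact h1 ▸ Finset.single_le_sum (f := T.bary x) (fun w _ => h0 w) hv
    · simp [Finsupp.notMem_support_iff.1 hv]
  · simp [bary_eq_zero_of_notMem_closure hx]

theorem exists_affineMap_eqOn_bary (hs : s ∈ T.cells) (v : 𝔼) :
    ∃ f : 𝔼 →ᵃ[ℝ] ℝ, Set.EqOn (T.bary · v) f (convexHull ℝ (s : Set 𝔼)) := by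
  by_cases hv : v ∈ s
  · exact ⟨(cellBasis hs).coord ⟨v, hv⟩, fun x hx => bary_eq_coord hs hx ⟨v, hv⟩⟩
  · exact ⟨0, fun x hx => bary_eq_zero_of_notMem hs.1 hx hv⟩

theorem abs_bary_sub_le_div (hs : s ∈ T.cells) {c : 𝔼} {r : ℝ} (hr : 0 < r)
    (hc : Metric.closedBall c r ⊆ convexHull ℝ (s : Set 𝔼)) (hx : x ∈ convexHull ℝ (s : Set 𝔼))
    (hy : y ∈ convexHull ℝ (s : Set 𝔼)) (v : 𝔼) :
    |T.bary x v - T.bary y v| ≤ ‖x - y‖ / r := by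
  obtain ⟨f, hf⟩ := exists_affineMap_eqOn_bary hs v
  have hf01 : ∀ z ∈ Metric.closedBall c r, f z ∈ Set.Icc (0 : ℝ) 1 := fun z hz =>
    hf (hc hz) ▸ T.bary_mem_Icc z v
  simpa only [hf hx, hf hy] using abs_affineMap_sub_le_div f hr hf01 x y

theorem eventually_mem_convexHull (T : Triangulation d Ω) (x : 𝔼) :
    ∀ᶠ y in 𝓝 x, ∀ s ∈ T.faces, y ∈ convexHull ℝ (s : Set 𝔼) → x ∈ convexHull ℝ (s : Set 𝔼) := by
  have : Finite T.faces := T.finite_faces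
  filter_upwards [(locallyFinite_of_finite fun s : T.faces =>
    convexHull ℝ (s.1 : Set 𝔼)).eventually_subset (fun s => isClosed_convexHull s.1) x]
    with y hy s hs hys using @hy ⟨s, hs⟩ hys

/-- Equality of the supports means that `x` and `y` lie in the relative interior of the same
simplex, and translation by `x - y` maps a neighbourhood of `y` in each element containing it into
that element. -/
theorem mem_interior_of_bary_support_eq (hx : x ∈ closure Ω) (hy : y ∈ interior (closure Ω))
    (hxy : (T.bary x).support = (T.bary y).support) : x ∈ interior (closure Ω) := by
  have hyΩ := interior_subset hy
  have hlim : Tendsto (fun δ => y + δ) (𝓝 (0 : 𝔼)) (𝓝 y) := by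
    simpa using (continuous_const_add y).tendsto (0 : 𝔼)
  have hcell : ∀ᶠ δ in 𝓝 (0 : 𝔼), ∀ s ∈ T.cells, y ∈ convexHull ℝ (s : Set 𝔼) →
      y + δ ∈ convexHull ℝ (s : Set 𝔼) → x + δ ∈ convexHull ℝ (s : Set 𝔼) := by
    refine (eventually_all_finite T.finite_cells).2 fun s hs => ?_
    by_cases hys : y ∈ convexHull ℝ (s : Set 𝔼)
    · have hxs : x ∈ convexHull ℝ (s : Set 𝔼) := by
        rwa [mem_convexHull_iff_bary_support hx hs.1, hxy,
          ← mem_convexHull_iff_bary_support hyΩ hs.1]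
      have hzero : ∀ v, (cellBasis hs).coord v x = 0 → (cellBasis hs).coord v y = 0 := fun v => by
        rw [← bary_eq_coord hs hxs, ← bary_eq_coord hs hys, ← Finsupp.notMem_support_iff,
          ← Finsupp.notMem_support_iff, hxy]
        exact id
      rw [← range_cellBasis hs] at hxs ⊢
      exact (eventually_add_mem_convexHull_of_coord_eq_zero _ hxs hzero).mono fun δ hδ _ => hδ
    · exact Eventually.of_forall fun δ h => absurd h hys
  have hmem : ∀ᶠ δ in 𝓝 (0 : 𝔼), x + δ ∈ closure Ω := by
    filter_upwards [hcell, hlim.eventually (mem_interior_iff_mem_nhds.1 hy),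
      hlim.eventually (T.eventually_mem_convexHull y)] with δ hδ hyδ hnear
    obtain ⟨s, hs, hyδs⟩ := T.exists_cell_of_mem_closure hyδ
    exact convexHull_face_subset hs.1 (hδ s hs (hnear s hs.1 hyδs) hyδs)
  have hsub : Tendsto (fun z => z - x) (𝓝 x) (𝓝 0) := by
    simpa using (continuous_sub_right x).tendsto x
  rw [mem_interior_iff_mem_nhds]
  filter_upwards [hsub.eventually hmem] with z hz
  simpa using hz

theorem bary_support_eq_of_mem_openSegment (hx : x ∈ closure Ω)
    (hy : y ∈ convexHull ℝ ((T.bary x).support : Set 𝔼)) (hz : z ∈ openSegment ℝ x y) :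
    (T.bary x).support = (T.bary z).support := by
  have hface := (isBary_bary (T := T) hx).2.1
  have hxt := (isBary_bary (T := T) hx).mem_convexHull subset_rfl
  have hzt := (convex_convexHull ℝ _).openSegment_subset hxt hy hz
  obtain ⟨s, hs, hts⟩ := exists_cell_superset hface
  have hle : convexHull ℝ ((T.bary x).support : Set 𝔼) ⊆ convexHull ℝ (s : Set 𝔼) :=
    convexHull_mono (Finset.coe_subset.2 hts)
  refine Finset.Subset.antisymm (fun v hv => ?_) (bary_support_subset hface hzt)
  obtain ⟨a, b, ha, hb, hab, rfl⟩ := hz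
  obtain ⟨f, hf⟩ := exists_affineMap_eqOn_bary hs v
  have hfz : T.bary (a • x + b • y) v = a * T.bary x v + b * T.bary y v := by
    have hcombo := Convex.combo_affine_apply (f := f) (x := x) (y := y) hab
    rwa [← hf (hle hxt), ← hf (hle hy), ← hf (hle hzt)] at hcombo
  have hxv : 0 < T.bary x v :=
    (T.bary_mem_Icc x v).1.lt_of_ne' (Finsupp.mem_support_iff.1 hv)
  have hyv : 0 ≤ T.bary y v := (T.bary_mem_Icc y v).1
  exact Finsupp.mem_support_iff.2 (hfz ▸ by positivity)

theorem convexHull_bary_support_subset_frontier (hx : x ∈ frontier (closure Ω)) :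
    convexHull ℝ ((T.bary x).support : Set 𝔼) ⊆ frontier (closure Ω) := by
  have hxΩ : x ∈ closure Ω := isClosed_closure.frontier_subset hx
  intro y hy
  refine ⟨subset_closure (convexHull_face_subset (isBary_bary hxΩ).2.1 hy), fun hyi => hx.2 ?_⟩
  obtain ⟨z, hzi, hz⟩ := mem_closure_iff.1
    (segment_subset_closure_openSegment (right_mem_segment ℝ x y)) _ isOpen_interior hyi
  exact mem_interior_of_bary_support_eq hxΩ hzi (bary_support_eq_of_mem_openSegment hxΩ hy hz)

theorem card_bary_support_le (hx : x ∈ frontier (closure Ω)) : (T.bary x).support.card ≤ d := by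
  have hxΩ : x ∈ closure Ω := isClosed_closure.frontier_subset hx
  have hb := isBary_bary (T := T) hxΩ
  by_contra! hcard
  obtain ⟨s, hs, hts⟩ := exists_cell_superset hb.2.1
  obtain rfl : (T.bary x).support = s := Finset.eq_of_subset_of_card_le hts (hs.2 ▸ hcard)
  refine hx.2 (interior_mono (convexHull_face_subset hs.1)
    ((mem_interior_convexHull_cell_iff hs).2 fun v => ?_))
  rw [← bary_eq_coord hs (hb.mem_convexHull subset_rfl)]
  exact (hb.1 v).lt_of_ne' (Finsupp.mem_support_iff.1 v.2)

/-- A point outside `closure Ω` is joined to a generic point of `Ω` by a segment that avoids all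
simplices of codimension at least two. -/
theorem frontier_subset_closure_setOf_le_card_bary_support (hΩ : IsOpen Ω) :
    frontier (closure Ω) ⊆ closure {w ∈ frontier (closure Ω) | d ≤ (T.bary w).support.card} := by
  intro x hx
  refine Metric.mem_closure_iff.2 fun ε hε => ?_
  obtain ⟨y, hyΩ, hyx⟩ := Metric.mem_closure_iff.1 (frontier_compl (closure Ω) ▸ hx).1 ε hε
  have hne : (Metric.ball x ε ∩ Ω).Nonempty := mem_closure_iff.1
    (isClosed_closure.frontier_subset hx) _ Metric.isOpen_ball (Metric.mem_ball_self hε)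
  have : Finite T.faces := T.finite_faces
  classical
  obtain ⟨z, ⟨hzx, hzΩ⟩, hz⟩ := (dense_setOf_forall_notMem_affineSubspace
    (S := fun t : {t : T.faces // t.1.card < d} =>
      affineSpan ℝ ((insert y t.1.1 : Finset 𝔼) : Set 𝔼)) fun t =>
    affineSpan_ne_top_of_card_le_finrank (by
      rw [finrank_euclideanSpace_fin]
      exact (Finset.card_insert_le _ _).trans t.2)).inter_open_nonempty _
    (Metric.isOpen_ball.inter hΩ) hne
  obtain ⟨w, hwyz, hw⟩ := inter_frontier_nonempty (convex_segment y z).isPreconnected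
    ⟨z, right_mem_segment ℝ y z, subset_closure hzΩ⟩ ⟨y, left_mem_segment ℝ y z, hyΩ⟩
  have hwΩ : w ∈ closure Ω := isClosed_closure.frontier_subset hw
  refine ⟨w, ⟨hw, ?_⟩, ?_⟩
  · by_contra! hcard
    have hb := isBary_bary (T := T) hwΩ
    refine hz ⟨⟨_, hb.2.1⟩, hcard⟩ ?_
    rw [segment_eq_image_lineMap] at hwyz
    obtain ⟨τ, -, rfl⟩ := hwyz
    have hτ : τ ≠ 0 := by
      rintro rfl
      exact hyΩ (by simpa using hwΩ)
    have hline : AffineMap.lineMap y (AffineMap.lineMap y z τ) τ⁻¹ = z := by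
      simp [AffineMap.lineMap_apply, smul_smul, hτ]
    rw [Finset.coe_insert]
    have hmem := AffineMap.lineMap_mem τ⁻¹ (subset_affineSpan ℝ _ (Set.mem_insert y _))
      (affineSpan_mono ℝ (Set.subset_insert y _)
        (convexHull_subset_affineSpan _ (hb.mem_convexHull subset_rfl)))
    rwa [hline] at hmem
  · rw [dist_comm]
    exact (convex_ball x ε).segment_subset (Metric.mem_ball'.2 hyx) hzx hwyz

theorem exists_facet_of_mem_frontier (T : Triangulation d Ω) (hΩ : interior (closure Ω) = Ω)
    (hx : x ∈ frontier Ω) :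
    ∃ t ∈ T.faces, t.card = d ∧ x ∈ convexHull ℝ (t : Set 𝔼) ∧
      convexHull ℝ (t : Set 𝔼) ⊆ frontier Ω := by
  have hopen : IsOpen Ω := hΩ ▸ isOpen_interior
  have hfr : frontier (closure Ω) = frontier Ω := by
    rw [frontier, closure_closure, hΩ, hopen.frontier_eq]
  rw [← hfr] at hx ⊢
  obtain ⟨w, ⟨hw, hcard⟩, hxw⟩ := ((mem_closure_iff_frequently.1
    (frontier_subset_closure_setOf_le_card_bary_support (T := T) hopen hx)).and_eventually
    (T.eventually_mem_convexHull x)).exists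
  have hb := isBary_bary (T := T) (isClosed_closure.frontier_subset hw)
  exact ⟨(T.bary w).support, hb.2.1, (card_bary_support_le hw).antisymm hcard,
    hxw _ hb.2.1 (hb.mem_convexHull subset_rfl), convexHull_bary_support_subset_frontier hw⟩

end Triangulation

theorem abs_prod_sub_prod_le {ι : Type*} (s : Finset ι) {f g : ι → ℝ} {M L : ℝ} (hM : 1 ≤ M)
    (hL : 0 ≤ L) (hf : ∀ i ∈ s, |f i| ≤ M) (hg : ∀ i ∈ s, |g i| ≤ M)
    (hfg : ∀ i ∈ s, |f i - g i| ≤ L) :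
    |∏ i ∈ s, f i - ∏ i ∈ s, g i| ≤ s.card * M ^ s.card * L := by
  classical
  induction s using Finset.induction_on with
  | empty => simp
  | insert i s hi ih =>
    rw [Finset.prod_insert hi, Finset.prod_insert hi, Finset.card_insert_of_notMem hi]
    have hsub := ih (fun j hj => hf j (Finset.mem_insert_of_mem hj))
      (fun j hj => hg j (Finset.mem_insert_of_mem hj))
      (fun j hj => hfg j (Finset.mem_insert_of_mem hj))
    have hprod : |∏ j ∈ s, g j| ≤ M ^ s.card := by
      rw [Finset.abs_prod, ← Finset.prod_const]
      exact Finset.prod_le_prod (fun _ _ => abs_nonneg _)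
        fun j hj => hg j (Finset.mem_insert_of_mem hj)
    have hpow : M ^ s.card ≤ M ^ (s.card + 1) := pow_le_pow_right₀ hM (Nat.le_succ _)
    calc |f i * ∏ j ∈ s, f j - g i * ∏ j ∈ s, g j|
        = |f i * (∏ j ∈ s, f j - ∏ j ∈ s, g j) + (f i - g i) * ∏ j ∈ s, g j| := by
          congr 1; ring
      _ ≤ |f i| * |∏ j ∈ s, f j - ∏ j ∈ s, g j| + |f i - g i| * |∏ j ∈ s, g j| := by
          rw [← abs_mul, ← abs_mul]; exact abs_add_le _ _
      _ ≤ M * (s.card * M ^ s.card * L) + L * M ^ s.card := by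
          refine add_le_add (mul_le_mul (hf i (Finset.mem_insert_self _ _)) hsub (abs_nonneg _)
            (by linarith)) (mul_le_mul (hfg i (Finset.mem_insert_self _ _)) hprod
            (abs_nonneg _) hL)
      _ ≤ M * (s.card * M ^ s.card * L) + L * M ^ (s.card + 1) := by gcongr
      _ = ((s.card + 1 : ℕ) : ℝ) * M ^ (s.card + 1) * L := by push_cast; ring

/-- The one-dimensional factors of the Lagrange basis functions. -/
def nodalFactor (k m : ℕ) (t : ℝ) : ℝ := ∏ j ∈ Finset.range m, ((k : ℝ) * t - j) / (j + 1)

theorem continuous_nodalFactor (k m : ℕ) : Continuous (nodalFactor k m) := by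
  unfold nodalFactor
  fun_prop

theorem nodalFactor_zero_right {k m : ℕ} (hm : m ≠ 0) : nodalFactor k m 0 = 0 :=
  Finset.prod_eq_zero (i := 0) (Finset.mem_range.2 (Nat.pos_of_ne_zero hm)) (by simp)

theorem abs_nodalFactor_factor_le {k m j : ℕ} (hm : m ≤ k) {t : ℝ} (ht : t ∈ Set.Icc (0 : ℝ) 1)
    (hj : j ∈ Finset.range m) : |((k : ℝ) * t - j) / (j + 1)| ≤ k := by
  have hjk : (j : ℝ) ≤ k := by exact_mod_cast (Finset.mem_range.1 hj).le.trans hm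
  have h1 : (0 : ℝ) ≤ k * t := mul_nonneg (Nat.cast_nonneg _) ht.1
  have h2 : (k : ℝ) * t ≤ k := mul_le_of_le_one_right (Nat.cast_nonneg _) ht.2
  rw [abs_div, abs_of_pos (by positivity : (0 : ℝ) < j + 1)]
  refine (div_le_self (abs_nonneg _) (by simp)).trans ?_
  rw [abs_le]
  constructor <;> linarith [(Nat.cast_nonneg j : (0 : ℝ) ≤ j)]

theorem abs_nodalFactor_le {k m : ℕ} (hk : 1 ≤ k) (hm : m ≤ k) {t : ℝ}
    (ht : t ∈ Set.Icc (0 : ℝ) 1) : |nodalFactor k m t| ≤ (k : ℝ) ^ k := by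
  have hk' : (1 : ℝ) ≤ k := by exact_mod_cast hk
  rw [nodalFactor, Finset.abs_prod]
  refine (Finset.prod_le_prod (fun _ _ => abs_nonneg _)
    fun j hj => abs_nodalFactor_factor_le hm ht hj).trans ?_
  rw [Finset.prod_const, Finset.card_range]
  exact pow_le_pow_right₀ hk' hm

theorem abs_nodalFactor_sub_le {k m : ℕ} (hk : 1 ≤ k) (hm : m ≤ k) {t t' : ℝ}
    (ht : t ∈ Set.Icc (0 : ℝ) 1) (ht' : t' ∈ Set.Icc (0 : ℝ) 1) :
    |nodalFactor k m t - nodalFactor k m t'| ≤ k * (k : ℝ) ^ k * (k * |t - t'|) := by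
  have hk' : (1 : ℝ) ≤ k := by exact_mod_cast hk
  have h := abs_prod_sub_prod_le (Finset.range m) (L := k * |t - t'|) hk' (by positivity)
    (fun j hj => abs_nodalFactor_factor_le hm ht hj)
    (fun j hj => abs_nodalFactor_factor_le hm ht' hj)
    (fun j _ => by
      rw [← sub_div, abs_div, abs_of_pos (by positivity : (0 : ℝ) < j + 1)]
      refine (div_le_self (abs_nonneg _) (by simp)).trans (le_of_eq ?_)
      rw [sub_sub_sub_cancel_right, ← mul_sub, abs_mul, abs_of_nonneg (by linarith)])
  refine h.trans ?_
  rw [Finset.card_range]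
  have : (m : ℝ) ≤ k := by exact_mod_cast hm
  have : (k : ℝ) ^ m ≤ (k : ℝ) ^ k := pow_le_pow_right₀ hk' hm
  gcongr

/-- A uniform bound for the Lagrange basis functions of degree `k`. -/
def nodalBound (k : ℕ) : ℝ := ((k : ℝ) ^ k) ^ k

/-- A uniform bound for the derivatives of the Lagrange basis functions of degree `k` with respect
to the barycentric coordinates. -/
def nodalLipBound (k : ℕ) : ℝ := k * ((k : ℝ) ^ k) ^ k * (k * (k : ℝ) ^ k * k)

namespace Triangulation

variable {d : ℕ} {Ω : Set (EuclideanSpace ℝ (Fin d))} {T : Triangulation d Ω} {k : ℕ}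
  {s t : Finset (EuclideanSpace ℝ (Fin d))} {c x y : EuclideanSpace ℝ (Fin d)} {r : ℝ}

local notation "𝔼" => EuclideanSpace ℝ (Fin d)

theorem nodalBasis_eq_prod_nodalFactor (a : T.Node k) (x : 𝔼) :
    T.nodalBasis k a x = ∏ v ∈ a.1.support, nodalFactor k (a.1 v) (T.bary x v) := rfl

theorem Node.apply_le (a : T.Node k) (v : 𝔼) : a.1 v ≤ k := by
  by_cases hv : v ∈ a.1.support
  · conv_rhs => rw [← a.2.2]
    exact Finset.single_le_sum (f := fun v => a.1 v) (fun _ _ => Nat.zero_le _) hv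
  · rw [Finsupp.notMem_support_iff.1 hv]
    exact Nat.zero_le _

theorem Node.card_support_le (a : T.Node k) : a.1.support.card ≤ k := by
  conv_rhs => rw [← a.2.2]
  rw [Finset.card_eq_sum_ones]
  exact Finset.sum_le_sum fun v hv => Nat.one_le_iff_ne_zero.2 (Finsupp.mem_support_iff.1 hv)

theorem Node.point_mem_convexHull (hk : 1 ≤ k) (a : T.Node k) (ht : a.1.support ⊆ t) :
    a.point ∈ convexHull ℝ (t : Set 𝔼) :=
  (a.isBary hk).mem_convexHull (Finsupp.support_mapRange.trans ht)

theorem Node.support_subset (hk : 1 ≤ k) (a : T.Node k) (ht : t ∈ T.faces)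
    (h : a.point ∈ convexHull ℝ (t : Set 𝔼)) : a.1.support ⊆ t := by
  have hk' : (k : ℝ) ≠ 0 := by positivity
  have hsupp := (mem_convexHull_iff_bary_support (convexHull_face_subset ht h) ht).1 h
  rw [(a.isBary hk).bary_eq] at hsupp
  exact fun v hv => hsupp (by simpa [hk'] using hv)

theorem support_subset_of_nodalBasis_ne_zero {a : T.Node k} (ht : t ∈ T.faces)
    (hx : x ∈ convexHull ℝ (t : Set 𝔼)) (h : T.nodalBasis k a x ≠ 0) : a.1.support ⊆ t := by
  intro v hv
  by_contra hvt
  rw [nodalBasis_eq_prod_nodalFactor, Finset.prod_ne_zero_iff] at h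
  refine h v hv ?_
  rw [bary_eq_zero_of_notMem ht hx hvt, nodalFactor_zero_right (Finsupp.mem_support_iff.1 hv)]

theorem abs_nodalBasis_le (hk : 1 ≤ k) (a : T.Node k) (x : 𝔼) :
    |T.nodalBasis k a x| ≤ nodalBound k := by
  have hk' : (1 : ℝ) ≤ k := by exact_mod_cast hk
  rw [nodalBasis_eq_prod_nodalFactor, Finset.abs_prod]
  refine (Finset.prod_le_prod (fun _ _ => abs_nonneg _)
    fun v _ => abs_nodalFactor_le hk (a.apply_le v) (bary_mem_Icc T x v)).trans ?_
  rw [Finset.prod_const]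
  exact pow_le_pow_right₀ (one_le_pow₀ hk') a.card_support_le

theorem abs_nodalBasis_sub_le_div (hk : 1 ≤ k) (a : T.Node k) (hs : s ∈ T.cells) (hr : 0 < r)
    (hc : Metric.closedBall c r ⊆ convexHull ℝ (s : Set 𝔼))
    (hx : x ∈ convexHull ℝ (s : Set 𝔼)) (hy : y ∈ convexHull ℝ (s : Set 𝔼)) :
    |T.nodalBasis k a x - T.nodalBasis k a y| ≤ nodalLipBound k / r * ‖x - y‖ := by
  have hk' : (1 : ℝ) ≤ k := by exact_mod_cast hk
  have hM : (1 : ℝ) ≤ (k : ℝ) ^ k := one_le_pow₀ hk'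
  have hfactor : ∀ v ∈ a.1.support, |nodalFactor k (a.1 v) (T.bary x v) -
      nodalFactor k (a.1 v) (T.bary y v)| ≤ k * (k : ℝ) ^ k * (k * (‖x - y‖ / r)) := fun v _ => by
    refine (abs_nodalFactor_sub_le hk (a.apply_le v) (bary_mem_Icc T x v)
      (bary_mem_Icc T y v)).trans ?_
    gcongr
    exact abs_bary_sub_le_div hs hr hc hx hy v
  have hcard : (a.1.support.card : ℝ) ≤ k := by exact_mod_cast a.card_support_le
  have hpow : ((k : ℝ) ^ k) ^ a.1.support.card ≤ ((k : ℝ) ^ k) ^ k :=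
    pow_le_pow_right₀ hM a.card_support_le
  calc |T.nodalBasis k a x - T.nodalBasis k a y|
      ≤ a.1.support.card * ((k : ℝ) ^ k) ^ a.1.support.card *
          (k * (k : ℝ) ^ k * (k * (‖x - y‖ / r))) :=
        abs_prod_sub_prod_le a.1.support hM (by positivity)
          (fun v _ => abs_nodalFactor_le hk (a.apply_le v) (bary_mem_Icc T x v))
          (fun v _ => abs_nodalFactor_le hk (a.apply_le v) (bary_mem_Icc T y v)) hfactor
    _ ≤ k * ((k : ℝ) ^ k) ^ k * (k * (k : ℝ) ^ k * (k * (‖x - y‖ / r))) := by gcongr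
    _ = nodalLipBound k / r * ‖x - y‖ := by unfold nodalLipBound; ring

theorem norm_gradient_nodalBasis_le_div (hk : 1 ≤ k) (a : T.Node k) (hs : s ∈ T.cells)
    (hr : 0 < r) (hc : Metric.closedBall c r ⊆ convexHull ℝ (s : Set 𝔼))
    (hx : x ∈ interior (convexHull ℝ (s : Set 𝔼))) :
    ‖∇ (T.nodalBasis k a) x‖ ≤ nodalLipBound k / r := by
  have hC : 0 ≤ nodalLipBound k / r := by unfold nodalLipBound; positivity
  have hLip : LipschitzOnWith ⟨nodalLipBound k / r, hC⟩ (T.nodalBasis k a)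
      (convexHull ℝ (s : Set 𝔼)) := by
    refine LipschitzOnWith.of_dist_le_mul fun y hy z hz => ?_
    rw [Real.dist_eq, dist_eq_norm]
    exact abs_nodalBasis_sub_le_div hk a hs hr hc hy hz
  rw [gradient, LinearIsometryEquiv.norm_map]
  exact norm_fderiv_le_of_lipschitzOn ℝ (mem_interior_iff_mem_nhds.1 hx) hLip

theorem support_subset_of_gradient_nodalBasis_ne_zero {a : T.Node k} (hs : s ∈ T.faces)
    (hx : x ∈ interior (convexHull ℝ (s : Set 𝔼))) (h : ∇ (T.nodalBasis k a) x ≠ 0) :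
    a.1.support ⊆ s := by
  by_contra ha
  have hzero : T.nodalBasis k a =ᶠ[𝓝 x] fun _ => 0 := by
    filter_upwards [mem_interior_iff_mem_nhds.1 hx] with y hy
    by_contra hne
    exact ha (support_subset_of_nodalBasis_ne_zero hs hy hne)
  exact h (by rw [gradient, hzero.fderiv_eq, fderiv_fun_const, Pi.zero_apply, map_zero])

theorem card_filter_support_subset_le [DecidableEq 𝔼] (T : Triangulation d Ω) (k : ℕ)
    (s : Finset 𝔼) :
    (Finset.univ.filter fun a : T.Node k => a.1.support ⊆ s).card ≤ (k + 1) ^ s.card := by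
  have hcard : Fintype.card (s → Fin (k + 1)) = (k + 1) ^ s.card := by simp
  rw [← hcard, ← Finset.card_univ]
  refine Finset.card_le_card_of_injOn
    (fun a v => ⟨a.1 v, Nat.lt_succ_of_le (a.apply_le v)⟩) (fun _ _ => Finset.mem_univ _) ?_
  intro a ha b hb hab
  simp only [Finset.coe_filter_univ, Set.mem_ofPred_eq] at ha hb
  refine Subtype.ext (Finsupp.ext fun v => ?_)
  by_cases hv : v ∈ s
  · exact congrArg Fin.val (congrFun hab ⟨v, hv⟩)
  · rw [Finsupp.notMem_support_iff.1 fun h => hv (ha h),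
      Finsupp.notMem_support_iff.1 fun h => hv (hb h)]

theorem meshWidth_nonneg (T : Triangulation d Ω) : 0 ≤ T.meshWidth :=
  Real.sSup_nonneg (by rintro _ ⟨s, _, rfl⟩; exact Metric.diam_nonneg)

theorem dist_le_meshWidth (hs : s ∈ T.cells) (hx : x ∈ convexHull ℝ (s : Set 𝔼))
    (hy : y ∈ convexHull ℝ (s : Set 𝔼)) : dist x y ≤ T.meshWidth :=
  (Metric.dist_le_diam_of_mem (s.finite_toSet.isCompact_convexHull ℝ).isBounded hx hy).trans
    (le_csSup (T.finite_cells.image _).bddAbove (Set.mem_image_of_mem _ hs))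

theorem meshWidth_pos (hd : d ≠ 0) (hs : s ∈ T.cells) : 0 < T.meshWidth := by
  obtain ⟨x, hx, y, hy, hxy⟩ := Finset.one_lt_card.1 (show 1 < s.card by rw [hs.2]; omega)
  exact (dist_pos.2 hxy).trans_le (dist_le_meshWidth hs (subset_convexHull ℝ _ hx)
    (subset_convexHull ℝ _ hy))

theorem ae_mem_interior_cell (T : Triangulation d Ω) :
    ∀ᵐ x ∂(volume.restrict Ω), ∃ s ∈ T.cells, x ∈ interior (convexHull ℝ (s : Set 𝔼)) := by
  have hfrontier : ∀ᵐ x : 𝔼, ∀ s ∈ T.cells, x ∉ frontier (convexHull ℝ (s : Set 𝔼)) := by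
    rw [ae_ball_iff T.finite_cells.countable]
    exact fun s _ => measure_eq_zero_iff_ae_notMem.1
      ((convex_convexHull ℝ (s : Set 𝔼)).addHaar_frontier volume)
  have hclosure : ∀ᵐ x ∂(volume.restrict Ω), x ∈ closure Ω :=
    ae_restrict_of_ae_restrict_of_subset subset_closure
      (ae_restrict_mem isClosed_closure.measurableSet)
  filter_upwards [ae_restrict_of_ae hfrontier, hclosure] with x hx hxc
  obtain ⟨s, hs, hxs⟩ := T.exists_cell_of_mem_closure hxc
  refine ⟨s, hs, ?_⟩
  by_contra hi
  exact hx s hs ⟨subset_closure hxs, hi⟩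

end Triangulation

section Gram

variable {X F ι ι' : Type*} [MeasurableSpace X] {ν : Measure X}

theorem integral_dotProduct_mulVec [Fintype ι] [Fintype ι'] {h : ι → ι' → X → ℝ}
    (hh : ∀ i j, Integrable (h i j) ν) (c : ι → ℝ) (x : ι' → ℝ) :
    ∫ y, c ⬝ᵥ (Matrix.of fun i j => h i j y).mulVec x ∂ν =
      c ⬝ᵥ (Matrix.of fun i j => ∫ y, h i j y ∂ν).mulVec x := by
  simp only [dotProduct, Matrix.mulVec, Matrix.of_apply]
  have hrow : ∀ i, Integrable (fun y => ∑ j, h i j y * x j) ν :=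
    fun i => integrable_finsetSum _ fun j _ => (hh i j).mul_const _
  rw [integral_finsetSum _ fun i _ => (hrow i).const_mul _]
  refine Finset.sum_congr rfl fun i _ => ?_
  rw [integral_const_mul, integral_finsetSum _ fun j _ => (hh i j).mul_const _]
  simp only [integral_mul_const]

theorem normSq_submatrix_le [Fintype ι] [Fintype ι'] {M : Matrix ι ι ℝ} {C : ℝ}
    (hM : ∀ u, normSq M u ≤ C * ∑ i, u i ^ 2) {e : ι' → ι} (he : e.Injective) (u : ι' → ℝ) :
    normSq (M.submatrix e e) u ≤ C * ∑ i, u i ^ 2 := by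
  classical
  have hsum : ∀ g : ι → ℝ, (∀ i ∉ Set.range e, g i = 0) → ∑ i, g i = ∑ i', g (e i') :=
    fun g hg => (Fintype.sum_of_injective e he _ g hg fun _ => rfl).symm
  have hext : ∀ i ∉ Set.range e, Function.extend e u 0 i = 0 :=
    fun i hi => Function.extend_apply' _ _ _ hi
  have h := hM (Function.extend e u 0)
  rw [hsum (fun i => Function.extend e u 0 i ^ 2) fun i hi => by simp [hext i hi]] at h
  simp only [normSq, dotProduct, Matrix.mulVec] at h ⊢
  rw [hsum _ fun i hi => by rw [hext i hi, zero_mul]] at h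
  simp only [fun i => hsum (fun j => M i j * Function.extend e u 0 j)
    fun j hj => by rw [hext j hj, mul_zero], he.extend_apply] at h
  exact h

theorem norm_sum_sq_le_of_card_le [Fintype ι] [SeminormedAddCommGroup F] {g : ι → F}
    {s : Finset ι} {N : ℕ} (hs : s.card ≤ N) (hg : ∀ i ∉ s, g i = 0) :
    ‖∑ i, g i‖ ^ 2 ≤ N * ∑ i, ‖g i‖ ^ 2 :=
  calc ‖∑ i, g i‖ ^ 2 = ‖∑ i ∈ s, g i‖ ^ 2 := by
        rw [Finset.sum_subset (Finset.subset_univ s) fun i _ hi => hg i hi]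
    _ ≤ (∑ i ∈ s, ‖g i‖) ^ 2 := by gcongr; exact norm_sum_le _ _
    _ ≤ s.card * ∑ i ∈ s, ‖g i‖ ^ 2 := sq_sum_le_card_mul_sum_sq
    _ ≤ N * ∑ i, ‖g i‖ ^ 2 := by gcongr; exact Finset.subset_univ _

variable [NormedAddCommGroup F] [InnerProductSpace ℝ F]

theorem integrable_inner_of_memLp_two {f g : X → F} (hf : MemLp f 2 ν) (hg : MemLp g 2 ν) :
    Integrable (fun x => inner ℝ (f x) (g x)) ν := by
  refine (L2.integrable_inner (𝕜 := ℝ) hf.toLp hg.toLp).congr ?_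
  filter_upwards [hf.coeFn_toLp, hg.coeFn_toLp] with x hfx hgx
  rw [hfx, hgx]

theorem normSq_integral_inner_le [Fintype ι] {w : X → ℝ} {f : ι → X → F} {A : ℝ} {N : ℕ}
    (hA : 0 ≤ A) (hw : AEStronglyMeasurable w ν) (hwA : ∀ᵐ x ∂ν, |w x| ≤ A)
    (hf : ∀ a, MemLp (f a) 2 ν)
    (hN : ∀ᵐ x ∂ν, ∃ s : Finset ι, s.card ≤ N ∧ ∀ a ∉ s, f a x = 0) (u : ι → ℝ) :
    normSq (Matrix.of fun a b => ∫ x, w x * inner ℝ (f a x) (f b x) ∂ν) u ≤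
      A * N * ∑ a, u a ^ 2 * ∫ x, ‖f a x‖ ^ 2 ∂ν := by
  have hint : ∀ a b, Integrable (fun x => w x * inner ℝ (f a x) (f b x)) ν :=
    fun a b => (integrable_inner_of_memLp_two (hf a) (hf b)).bdd_mul hw hwA
  have hsq : ∀ a, Integrable (fun x => u a ^ 2 * ‖f a x‖ ^ 2) ν :=
    fun a => ((hf a).integrable_norm_pow two_ne_zero).const_mul _
  have hsq_sum : Integrable (fun x => A * N * ∑ a, u a ^ 2 * ‖f a x‖ ^ 2) ν :=
    (integrable_finsetSum _ fun a _ => hsq a).const_mul _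
  have hquad : ∀ x, u ⬝ᵥ (Matrix.of fun a b => w x * inner ℝ (f a x) (f b x)).mulVec u =
      w x * ‖∑ a, u a • f a x‖ ^ 2 := fun x => by
    rw [← real_inner_self_eq_norm_sq, ← Matrix.star_dotProduct_gram_mulVec, star_trivial,
      ← smul_eq_mul, ← dotProduct_smul, ← Matrix.smul_mulVec]
    rfl
  calc normSq (Matrix.of fun a b => ∫ x, w x * inner ℝ (f a x) (f b x) ∂ν) u
      = ∫ x, w x * ‖∑ a, u a • f a x‖ ^ 2 ∂ν := by
        rw [normSq, ← integral_dotProduct_mulVec hint]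
        simp only [hquad]
    _ ≤ ∫ x, A * N * ∑ a, u a ^ 2 * ‖f a x‖ ^ 2 ∂ν := by
        refine integral_mono_ae (((memLp_finsetSum _ fun a _ =>
          (hf a).const_smul (u a)).integrable_norm_pow two_ne_zero).bdd_mul hw hwA) hsq_sum ?_
        filter_upwards [hwA, hN] with x hx ⟨s, hs, hs0⟩
        have hsum := norm_sum_sq_le_of_card_le (g := fun a => u a • f a x) hs
          fun a ha => by rw [hs0 a ha, smul_zero]
        simp only [norm_smul, mul_pow, Real.norm_eq_abs, sq_abs] at hsum
        rw [mul_assoc A]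
        exact mul_le_mul ((le_abs_self _).trans hx) hsum (sq_nonneg _) hA
    _ = A * N * ∑ a, u a ^ 2 * ∫ x, ‖f a x‖ ^ 2 ∂ν := by
        rw [integral_const_mul, integral_finsetSum _ fun a _ => hsq a]
        simp only [integral_const_mul]

end Gram

theorem integral_norm_sq_le_of_support_subset {X F : Type*} [MeasurableSpace X]
    [SeminormedAddCommGroup F] {ν : Measure X} {f : X → F} {D : ℝ} {S : Set X}
    (hS : MeasurableSet S) (hfin : ν S ≠ ⊤) (hD : ∀ᵐ x ∂ν, ‖f x‖ ≤ D)
    (hsupp : ∀ᵐ x ∂ν, f x ≠ 0 → x ∈ S) : ∫ x, ‖f x‖ ^ 2 ∂ν ≤ D ^ 2 * ν.real S := by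
  have hind : ∫ x, S.indicator (fun _ => D ^ 2) x ∂ν = D ^ 2 * ν.real S := by
    rw [integral_indicator_const _ hS, smul_eq_mul, mul_comm]
  rw [← hind]
  refine integral_mono_of_nonneg (Eventually.of_forall fun _ => sq_nonneg _)
    ((integrable_indicator_iff hS).2 (integrableOn_const hfin)) ?_
  filter_upwards [hD, hsupp] with x hx hxS
  by_cases h : f x = 0
  · rw [h, norm_zero, zero_pow two_ne_zero]
    exact Set.indicator_nonneg (fun _ _ => sq_nonneg _) _
  · rw [Set.indicator_of_mem (hxS h)]
    gcongr

namespace Triangulation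

variable {d : ℕ} {Ω : Set (EuclideanSpace ℝ (Fin d))} {T : Triangulation d Ω} {k : ℕ}

local notation "𝔼" => EuclideanSpace ℝ (Fin d)

theorem isFiniteMeasure_restrict_domain (T : Triangulation d Ω) :
    IsFiniteMeasure (volume.restrict Ω) := by
  rw [isFiniteMeasure_restrict]
  exact ((measure_mono subset_closure).trans_lt T.isCompact_closure.measure_lt_top).ne

/-- Each function is supported on the cells containing its node, hence on a ball of radius `h`, and
at most `(k + 1) ^ (d + 1)` of them overlap at a point. -/
theorem normSq_integral_inner_le_of_support_subset {F : Type*} [NormedAddCommGroup F]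
    [InnerProductSpace ℝ F] (hk : 1 ≤ k) {w : 𝔼 → ℝ} {f : T.Node k → 𝔼 → F} {A D : ℝ}
    (hA : 0 ≤ A) (hw : AEStronglyMeasurable w (volume.restrict Ω))
    (hwA : ∀ᵐ x ∂(volume.restrict Ω), |w x| ≤ A)
    (hf : ∀ a, AEStronglyMeasurable (f a) (volume.restrict Ω))
    (hbound : ∀ s ∈ T.cells, ∀ x ∈ interior (convexHull ℝ (s : Set 𝔼)), ∀ a, ‖f a x‖ ≤ D)
    (hsupp : ∀ s ∈ T.cells, ∀ x ∈ interior (convexHull ℝ (s : Set 𝔼)), ∀ a, f a x ≠ 0 →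
      a.1.support ⊆ s) (u : T.Node k → ℝ) :
    normSq (Matrix.of fun a b => ∫ x in Ω, w x * inner ℝ (f a x) (f b x)) u ≤
      A * (k + 1) ^ (d + 1) * (D ^ 2 * (T.meshWidth ^ d * volume.real (Metric.ball (0 : 𝔼) 1))) *
        ∑ a, u a ^ 2 := by
  classical
  have := T.isFiniteMeasure_restrict_domain
  have hD : ∀ a, ∀ᵐ x ∂(volume.restrict Ω), ‖f a x‖ ≤ D := fun a => by
    filter_upwards [T.ae_mem_interior_cell] with x ⟨s, hs, hx⟩ using hbound s hs x hx a
  have hoverlap : ∀ᵐ x ∂(volume.restrict Ω), ∃ S : Finset (T.Node k),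
      S.card ≤ (k + 1) ^ (d + 1) ∧ ∀ a ∉ S, f a x = 0 := by
    filter_upwards [T.ae_mem_interior_cell] with x ⟨s, hs, hx⟩
    refine ⟨_, hs.2 ▸ card_filter_support_subset_le T k s, fun a ha => ?_⟩
    by_contra h
    exact ha (Finset.mem_filter.2 ⟨Finset.mem_univ a, hsupp s hs x hx a h⟩)
  have hball : ∀ a, ∫ x in Ω, ‖f a x‖ ^ 2 ≤
      D ^ 2 * (T.meshWidth ^ d * volume.real (Metric.ball (0 : 𝔼) 1)) := by
    intro a
    refine (integral_norm_sq_le_of_support_subset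
      (S := Metric.closedBall a.point T.meshWidth) Metric.isClosed_closedBall.measurableSet
      (measure_ne_top _ _) (hD a) ?_).trans ?_
    · filter_upwards [T.ae_mem_interior_cell] with x ⟨s, hs, hx⟩ h
      exact dist_le_meshWidth hs (interior_subset hx)
        (a.point_mem_convexHull hk (hsupp s hs x hx a h))
    · have hvol := Measure.addHaar_real_closedBall (volume : Measure 𝔼) a.point T.meshWidth_nonneg
      rw [finrank_euclideanSpace_fin] at hvol
      rw [← hvol]
      gcongr
      exact ENNReal.toReal_mono measure_closedBall_lt_top.ne (Measure.restrict_apply_le _ _)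
  calc normSq (Matrix.of fun a b => ∫ x in Ω, w x * inner ℝ (f a x) (f b x)) u
      ≤ A * ((k + 1) ^ (d + 1) : ℕ) * ∑ a, u a ^ 2 * ∫ x in Ω, ‖f a x‖ ^ 2 :=
        normSq_integral_inner_le hA hw hwA (fun a => MemLp.of_bound (hf a) D (hD a)) hoverlap u
    _ ≤ A * ((k + 1) ^ (d + 1) : ℕ) * ∑ a, u a ^ 2 *
          (D ^ 2 * (T.meshWidth ^ d * volume.real (Metric.ball (0 : 𝔼) 1))) := by
        gcongr with a
        exact hball a
    _ = A * (k + 1) ^ (d + 1) * (D ^ 2 * (T.meshWidth ^ d * volume.real (Metric.ball (0 : 𝔼) 1))) *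
          ∑ a, u a ^ 2 := by
        rw [← Finset.sum_mul]
        push_cast
        ring

theorem normSq_massMatrix_le (hk : 1 ≤ k) (u : T.Node k → ℝ) :
    normSq (T.massMatrix k) u ≤
      (k + 1) ^ (d + 1) * (nodalBound k ^ 2 *
        (T.meshWidth ^ d * volume.real (Metric.ball (0 : 𝔼) 1))) * ∑ a, u a ^ 2 := by
  have hmass : T.massMatrix k = Matrix.of fun a b =>
      ∫ x in Ω, 1 * inner ℝ (T.nodalBasis k a x) (T.nodalBasis k b x) := by
    simp only [massMatrix, one_mul, RCLike.inner_apply', conj_trivial]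
  rw [hmass, ← one_mul ((k + 1 : ℝ) ^ (d + 1))]
  exact normSq_integral_inner_le_of_support_subset hk zero_le_one aestronglyMeasurable_const
    (Eventually.of_forall fun _ => abs_one.le)
    (fun a => ((nodalBasis_mem a).1.aestronglyMeasurable
      isClosed_closure.measurableSet).mono_measure (Measure.restrict_mono subset_closure le_rfl))
    (fun _ _ x _ a => abs_nodalBasis_le hk a x)
    (fun s hs x hx a h => support_subset_of_nodalBasis_ne_zero hs.1 (interior_subset hx) h) u

theorem normSq_stiffnessMatrix_le (hd : d ≠ 0) (hk : 1 ≤ k) {κ : ℝ} (hκ : 0 < κ)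
    (hT : T.QuasiUniform κ) {α : 𝔼 → ℝ} {A : ℝ} (hA : 0 ≤ A)
    (hα : AEStronglyMeasurable α (volume.restrict Ω))
    (hαA : ∀ᵐ x ∂(volume.restrict Ω), |α x| ≤ A) (u : T.Node k → ℝ) :
    normSq (T.stiffnessMatrix k α) u ≤
      A * (k + 1) ^ (d + 1) * ((nodalLipBound k / (T.meshWidth / κ)) ^ 2 *
        (T.meshWidth ^ d * volume.real (Metric.ball (0 : 𝔼) 1))) * ∑ a, u a ^ 2 := by
  refine normSq_integral_inner_le_of_support_subset hk hA hα hαA (fun a => ?_)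
    (fun s hs x hx a => ?_)
    (fun s hs x hx a h => support_subset_of_gradient_nodalBasis_ne_zero hs.1 hx h) u
  · exact ((InnerProductSpace.toDual ℝ _).symm.continuous.measurable.comp
      (measurable_fderiv ℝ (T.nodalBasis k a))).aestronglyMeasurable
  · obtain ⟨c, hc⟩ := hT s hs
    exact norm_gradient_nodalBasis_le_div hk a hs (div_pos (meshWidth_pos hd hs) hκ) hc hx

end Triangulation

theorem exists_norm_sq_le_mul_of_pos {E : Type*} [NormedAddCommGroup E] [NormedSpace ℝ E]
    [ProperSpace E] {Q : E → ℝ} (hQ : Continuous Q) (hsmul : ∀ (r : ℝ) x, Q (r • x) = r ^ 2 * Q x)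
    (hpos : ∀ x ≠ 0, 0 < Q x) : ∃ C : ℝ, 0 ≤ C ∧ ∀ x, ‖x‖ ^ 2 ≤ C * Q x := by
  have hzero : Q 0 = 0 := by simpa using hsmul 0 0
  rcases subsingleton_or_nontrivial E with _ | _
  · exact ⟨0, le_rfl, fun x => by simp [Subsingleton.elim x 0]⟩
  obtain ⟨x₀, hx₀, hmin⟩ := (isCompact_sphere (0 : E) 1).exists_isMinOn
    (NormedSpace.sphere_nonempty.2 zero_le_one) hQ.continuousOn
  have hQx₀ : 0 < Q x₀ := hpos x₀ (ne_zero_of_mem_unit_sphere ⟨x₀, hx₀⟩)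
  refine ⟨(Q x₀)⁻¹, by positivity, fun x => ?_⟩
  rcases eq_or_ne x 0 with rfl | hx
  · simp [hzero]
  have hn : 0 < ‖x‖ := norm_pos_iff.2 hx
  have hle : Q x₀ ≤ Q (‖x‖⁻¹ • x) := hmin (by simp [norm_smul, hn.ne'])
  rw [hsmul, inv_pow, inv_mul_eq_div, le_div_iff₀ (by positivity)] at hle
  rwa [inv_mul_eq_div, le_div_iff₀ hQx₀, mul_comm]

theorem integral_sum_mul_sum {X ι ι' : Type*} [MeasurableSpace X] {ν : Measure X} [Fintype ι]
    [Fintype ι'] {f : ι → X → ℝ} {g : ι' → X → ℝ} (hf : ∀ i, MemLp (f i) 2 ν)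
    (hg : ∀ j, MemLp (g j) 2 ν) (c : ι → ℝ) (x : ι' → ℝ) :
    ∫ y, (∑ i, c i * f i y) * ∑ j, x j * g j y ∂ν =
      c ⬝ᵥ (Matrix.of fun i j => ∫ y, f i y * g j y ∂ν).mulVec x := by
  rw [← integral_dotProduct_mulVec (h := fun i j y => f i y * g j y) fun i j =>
    (hf i).integrable_mul (hg j)]
  refine integral_congr_ae (Eventually.of_forall fun y => ?_)
  simp only [dotProduct, Matrix.mulVec, Matrix.of_apply]
  rw [Finset.sum_mul_sum]
  simp only [Finset.mul_sum]
  exact Finset.sum_congr rfl fun i _ => Finset.sum_congr rfl fun j _ => by ring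

section ReferenceSimplex

variable {m k : ℕ} {y : EuclideanSpace ℝ (Fin m)}

/-- The barycentric coordinates of `y` with respect to the vertices `0, e_1, …, e_m` of the
reference simplex, the coordinate of the vertex `0` coming first. -/
def refCoord (y : EuclideanSpace ℝ (Fin m)) : Fin (m + 1) → ℝ :=
  Fin.cons (1 - ∑ i, y i) fun i => y i

@[simp] theorem refCoord_zero (y : EuclideanSpace ℝ (Fin m)) : refCoord y 0 = 1 - ∑ i, y i := rfl

@[simp] theorem refCoord_succ (y : EuclideanSpace ℝ (Fin m)) (i : Fin m) :
    refCoord y i.succ = y i := rfl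

theorem sum_refCoord (y : EuclideanSpace ℝ (Fin m)) : ∑ i, refCoord y i = 1 := by
  rw [Fin.sum_univ_succ]
  simp

theorem continuous_refCoord (i : Fin (m + 1)) :
    Continuous fun y : EuclideanSpace ℝ (Fin m) => refCoord y i := by
  cases i using Fin.cases with
  | zero => simp only [refCoord_zero]; fun_prop
  | succ i => simp only [refCoord_succ]; fun_prop

theorem exists_refCoord_eq {w : Fin (m + 1) → ℝ} (hw : ∑ i, w i = 1) :
    ∃ y : EuclideanSpace ℝ (Fin m), refCoord y = w := by
  refine ⟨WithLp.toLp 2 fun i => w i.succ, funext fun i => ?_⟩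
  rw [Fin.sum_univ_succ] at hw
  cases i using Fin.cases with
  | zero => simp only [refCoord_zero]; linarith
  | succ i => rw [refCoord_succ]

theorem refCoord_lineMap (x y : EuclideanSpace ℝ (Fin m)) (r : ℝ) (i : Fin (m + 1)) :
    refCoord (AffineMap.lineMap x y r) i = (1 - r) * refCoord x i + r * refCoord y i := by
  cases i using Fin.cases with
  | zero =>
    simp only [AffineMap.lineMap_apply_module, refCoord_zero, PiLp.add_apply, PiLp.smul_apply,
      smul_eq_mul, Finset.sum_add_distrib, ← Finset.mul_sum]
    ring
  | succ i => simp [AffineMap.lineMap_apply_module]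

/-- The open reference simplex. -/
def refSimplex (m : ℕ) : Set (EuclideanSpace ℝ (Fin m)) := {y | ∀ i, 0 < refCoord y i}

theorem isOpen_refSimplex (m : ℕ) : IsOpen (refSimplex m) := by
  simp only [refSimplex, Set.ofPred_forall]
  exact isOpen_iInter_of_finite fun i => isOpen_lt continuous_const (continuous_refCoord i)

theorem refSimplex_nonempty (m : ℕ) : (refSimplex m).Nonempty := by
  obtain ⟨y, hy⟩ := exists_refCoord_eq (w := fun _ : Fin (m + 1) => ((m : ℝ) + 1)⁻¹)
    (by simp; field_simp)
  exact ⟨y, fun i => by rw [hy]; positivity⟩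

theorem mem_closure_refSimplex (hy : ∀ i, 0 ≤ refCoord y i) : y ∈ closure (refSimplex m) := by
  obtain ⟨z, hz⟩ := refSimplex_nonempty m
  have hlim : Tendsto (AffineMap.lineMap y z) (𝓝[>] (0 : ℝ)) (𝓝 y) :=
    (AffineMap.lineMap_continuous.tendsto' 0 y (AffineMap.lineMap_apply_zero y z)).mono_left
      nhdsWithin_le_nhds
  refine mem_closure_of_tendsto hlim ?_
  filter_upwards [Ioo_mem_nhdsGT (zero_lt_one' ℝ)] with r hr i
  rw [refCoord_lineMap]
  exact add_pos_of_nonneg_of_pos (mul_nonneg (sub_nonneg.2 hr.2.le) (hy i)) (mul_pos hr.1 (hz i))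

theorem norm_le_sum_abs (y : EuclideanSpace ℝ (Fin m)) : ‖y‖ ≤ ∑ i, |y i| := by
  rw [EuclideanSpace.norm_eq]
  simp only [Real.norm_eq_abs]
  exact Real.sqrt_le_iff.2 ⟨Finset.sum_nonneg fun _ _ => abs_nonneg _,
    Finset.sum_sq_le_sq_sum_of_nonneg fun _ _ => abs_nonneg _⟩

theorem norm_le_one_of_refCoord_nonneg (hy : ∀ i, 0 ≤ refCoord y i) : ‖y‖ ≤ 1 :=
  calc ‖y‖ ≤ ∑ i, |y i| := norm_le_sum_abs y
    _ = ∑ i, y i := Finset.sum_congr rfl fun i _ => abs_of_nonneg (hy i.succ)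
    _ ≤ 1 := sub_nonneg.1 (hy 0)

theorem refSimplex_subset_closedBall (m : ℕ) : refSimplex m ⊆ Metric.closedBall 0 1 :=
  fun _ hy => mem_closedBall_zero_iff.2 (norm_le_one_of_refCoord_nonneg fun i => (hy i).le)

/-- The exponents of the Lagrange nodes of degree `k` of the reference simplex: `α` stands for the
point with barycentric coordinates `α_i / k`. -/
abbrev RefIndex (m k : ℕ) : Type := Finset.finAntidiagonal (m + 1) k

theorem RefIndex.sum_eq (α : RefIndex m k) : ∑ i, α.1 i = k := Finset.mem_finAntidiagonal.1 α.2

/-- The Lagrange basis function of degree `k` of the node `α` of the reference simplex. -/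
def refShape (α : RefIndex m k) (y : EuclideanSpace ℝ (Fin m)) : ℝ :=
  ∏ i, nodalFactor k (α.1 i) (refCoord y i)

theorem continuous_refShape (α : RefIndex m k) : Continuous (refShape α) :=
  continuous_finsetProd _ fun i _ => (continuous_nodalFactor _ _).comp (continuous_refCoord i)

theorem nodalFactor_div_ne_zero_iff (hk : 1 ≤ k) {i j : ℕ} :
    nodalFactor k i ((j : ℝ) / k) ≠ 0 ↔ i ≤ j := by
  have hk' : (k : ℝ) ≠ 0 := by positivity
  have hfactor : ∀ l : ℕ, ((j : ℝ) - l) / (l + 1) ≠ 0 ↔ l ≠ j := fun l => by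
    rw [div_ne_zero_iff, sub_ne_zero, Nat.cast_injective.ne_iff, ne_comm]
    exact and_iff_left (by positivity)
  simp only [nodalFactor, mul_div_cancel₀ _ hk', Finset.prod_ne_zero_iff, hfactor,
    Finset.mem_range]
  exact ⟨fun h => not_lt.1 fun hji => h j hji rfl, fun h l hl => (hl.trans_le h).ne⟩

theorem refShape_ne_zero_iff (hk : 1 ≤ k) {α β : RefIndex m k}
    (hy : ∀ i, refCoord y i = (β.1 i : ℝ) / k) : refShape α y ≠ 0 ↔ α = β := by
  simp only [refShape, hy, Finset.prod_ne_zero_iff, nodalFactor_div_ne_zero_iff hk]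
  refine ⟨fun hle => Subtype.ext (funext fun i => ?_), fun h i _ => h ▸ le_rfl⟩
  exact (Finset.sum_eq_sum_iff_of_le hle).1 (α.sum_eq.trans β.sum_eq.symm) i (Finset.mem_univ i)

theorem memLp_restrict_of_isCompact {X : Type*} [TopologicalSpace X] [MeasurableSpace X]
    [OpensMeasurableSpace X] {ν : Measure X} {K : Set X} (hK : IsCompact K)
    (hKm : MeasurableSet K) (hν : ν K ≠ ⊤) {f : X → ℝ} (hf : ContinuousOn f K) {p : ENNReal} :
    MemLp f p (ν.restrict K) := by
  have : IsFiniteMeasure (ν.restrict K) := isFiniteMeasure_restrict.2 hν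
  obtain ⟨C, hC⟩ := hK.exists_bound_of_continuousOn hf
  exact .of_bound (hf.aestronglyMeasurable_of_isCompact hK hKm) C
    ((ae_restrict_iff' hKm).2 (Eventually.of_forall hC))

theorem memLp_refSimplex {f : EuclideanSpace ℝ (Fin m) → ℝ} (hf : Continuous f) :
    MemLp f 2 (volume.restrict (refSimplex m)) :=
  (memLp_restrict_of_isCompact (isCompact_closedBall 0 1) measurableSet_closedBall
    (isCompact_closedBall 0 1).measure_lt_top.ne hf.continuousOn).mono_measure
    (Measure.restrict_mono (refSimplex_subset_closedBall m) le_rfl)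

/-- A combination that vanishes on the open simplex vanishes on its closure, which contains the
Lagrange nodes, and its nodal values are its coefficients up to nonzero factors. -/
theorem integral_refShape_pos (hk : 1 ≤ k) {c : RefIndex m k → ℝ} (hc : c ≠ 0) :
    0 < ∫ y in refSimplex m, (∑ α, c α * refShape α y) ^ 2 := by
  have hcont : Continuous fun y : EuclideanSpace ℝ (Fin m) => ∑ α, c α * refShape α y :=
    continuous_finsetSum _ fun α _ => continuous_const.mul (continuous_refShape α)
  refine (integral_nonneg fun _ => sq_nonneg _).lt_of_ne' fun hzero => hc (funext fun β => ?_)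
  rw [integral_eq_zero_iff_of_nonneg (fun _ => sq_nonneg _)
    (memLp_refSimplex hcont).integrable_sq] at hzero
  have heqOn : Set.EqOn (fun y => (∑ α, c α * refShape α y) ^ 2) 0 (closure (refSimplex m)) :=
    (Measure.eqOn_open_of_ae_eq hzero (isOpen_refSimplex m) (hcont.pow 2).continuousOn
      continuousOn_const).closure (hcont.pow 2) continuous_const
  have hk' : (k : ℝ) ≠ 0 := by positivity
  obtain ⟨y, hy⟩ := exists_refCoord_eq (w := fun i => (β.1 i : ℝ) / k)
    (by rw [← Finset.sum_div, ← Nat.cast_sum, β.sum_eq, div_self hk'])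
  have hy' := congrFun hy
  have hval : ∑ α, c α * refShape α y = 0 :=
    sq_eq_zero_iff.1 (heqOn (mem_closure_refSimplex fun i => by rw [hy']; positivity))
  rw [Finset.sum_eq_single β (fun α _ hα => by
    rw [not_not.1 (mt (refShape_ne_zero_iff hk hy').1 hα), mul_zero]) (by simp)] at hval
  exact (mul_eq_zero.1 hval).resolve_right ((refShape_ne_zero_iff hk hy').2 rfl)

theorem exists_sum_sq_le_integral_refShape (m : ℕ) (hk : 1 ≤ k) :
    ∃ C : ℝ, 0 ≤ C ∧ ∀ c : RefIndex m k → ℝ,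
      ∑ α, c α ^ 2 ≤ C * ∫ y in refSimplex m, (∑ α, c α * refShape α y) ^ 2 := by
  set Q : EuclideanSpace ℝ (RefIndex m k) → ℝ :=
    fun c => ∫ y in refSimplex m, (∑ α, c α * refShape α y) ^ 2 with hQ
  have hcont : Continuous Q := by
    simp only [hQ, sq, integral_sum_mul_sum (fun α => memLp_refSimplex (continuous_refShape α))
      (fun α => memLp_refSimplex (continuous_refShape α))]
    fun_prop
  have hsmul : ∀ (r : ℝ) c, Q (r • c) = r ^ 2 * Q c := fun r c => by
    simp only [hQ, ← integral_const_mul, ← mul_pow, Finset.mul_sum, PiLp.smul_apply, smul_eq_mul,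
      mul_assoc]
  have hpos : ∀ c ≠ 0, 0 < Q c := fun c hc =>
    integral_refShape_pos hk fun h => hc (WithLp.ofLp_injective 2 h)
  obtain ⟨C, hC0, hC⟩ := exists_norm_sq_le_mul_of_pos hcont hsmul hpos
  refine ⟨C, hC0, fun c => ?_⟩
  have h := hC (WithLp.toLp 2 c)
  rwa [EuclideanSpace.real_norm_sq_eq] at h

theorem exists_sum_sq_le_integral_refShape_comp (m : ℕ) (hk : 1 ≤ k) :
    ∃ C : ℝ, 0 ≤ C ∧ ∀ {ι : Type*} [Fintype ι] {e : ι → RefIndex m k} (_ : e.Injective)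
      (c : ι → ℝ), ∑ i, c i ^ 2 ≤ C * ∫ y in refSimplex m, (∑ i, c i * refShape (e i) y) ^ 2 := by
  obtain ⟨C, hC0, hC⟩ := exists_sum_sq_le_integral_refShape m hk
  refine ⟨C, hC0, fun {ι} _ {e} he c => ?_⟩
  have hsum : ∀ F : RefIndex m k → ℝ → ℝ, (∀ α, F α 0 = 0) →
      ∑ α, F α (Function.extend e c 0 α) = ∑ i, F (e i) (c i) := fun F hF =>
    (Fintype.sum_of_injective e he _ _ (fun α hα => by
      rw [Function.extend_apply' _ _ _ hα, Pi.zero_apply, hF]) fun i => by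
      rw [he.extend_apply]).symm
  have h := hC (Function.extend e c 0)
  rw [hsum (fun _ r => r ^ 2) (by simp)] at h
  simp only [fun y => hsum (fun α r => r * refShape α y) (by simp)] at h
  exact h

end ReferenceSimplex

section Hausdorff

variable {X Y : Type*} [MetricSpace X] [MeasurableSpace X] [BorelSpace X] [MetricSpace Y]
  [MeasurableSpace Y] [BorelSpace Y] {K : NNReal} {f : X → Y}

theorem euclideanHausdorffMeasure_image_le_of_lipschitzWith (hf : LipschitzWith K f) (m : ℕ)
    (s : Set X) : μHE[m] (f '' s) ≤ (K : ENNReal) ^ m * μHE[m] s := by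
  simp only [Measure.euclideanHausdorffMeasure_def, Measure.smul_apply]
  rw [ENNReal.smul_def, ENNReal.smul_def, smul_eq_mul, smul_eq_mul, mul_left_comm,
    ← ENNReal.rpow_natCast]
  gcongr
  exact hf.hausdorffMeasure_image_le (Nat.cast_nonneg m) s

theorem le_euclideanHausdorffMeasure_image_of_antilipschitzWith (hf : AntilipschitzWith K f)
    (m : ℕ) (s : Set X) : μHE[m] s ≤ (K : ENNReal) ^ m * μHE[m] (f '' s) := by
  simp only [Measure.euclideanHausdorffMeasure_def, Measure.smul_apply]
  rw [ENNReal.smul_def, ENNReal.smul_def, smul_eq_mul, smul_eq_mul, mul_left_comm,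
    ← ENNReal.rpow_natCast]
  gcongr
  exact hf.le_hausdorffMeasure_image (Nat.cast_nonneg m) s

theorem setIntegral_comp_le_of_antilipschitzWith (hf : AntilipschitzWith K f)
    (hemb : MeasurableEmbedding f) {m : ℕ} {D : Set X} {g : Y → ℝ} (hg0 : ∀ y, 0 ≤ g y)
    (hg : IntegrableOn g (f '' D) μHE[m]) :
    ∫ x in D, g (f x) ∂μHE[m] ≤ (K : ℝ) ^ m * ∫ y in f '' D, g y ∂μHE[m] := by
  have hle : (μHE[m].restrict D).map f ≤ (K ^ m) • μHE[m].restrict (f '' D) := by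
    refine Measure.le_iff.2 fun S hS => ?_
    rw [Measure.map_apply hemb.measurable hS, Measure.restrict_apply (hemb.measurable hS),
      Measure.smul_apply, Measure.restrict_apply hS, Set.inter_comm S, ← Set.image_inter_preimage,
      Set.inter_comm _ D, ENNReal.smul_def, ENNReal.coe_pow, smul_eq_mul]
    exact le_euclideanHausdorffMeasure_image_of_antilipschitzWith hf m _
  calc ∫ x in D, g (f x) ∂μHE[m] = ∫ y, g y ∂(μHE[m].restrict D).map f :=
        (hemb.integral_map g).symm
    _ ≤ ∫ y, g y ∂((K ^ m) • μHE[m].restrict (f '' D)) :=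
        integral_mono_measure hle (Eventually.of_forall hg0) hg.smul_measure_nnreal
    _ = (K : ℝ) ^ m * ∫ y in f '' D, g y ∂μHE[m] := by
        rw [integral_smul_nnreal_measure, NNReal.smul_def, smul_eq_mul, NNReal.coe_pow]

end Hausdorff

section SimplexMap

variable {E : Type*} [NormedAddCommGroup E] [NormedSpace ℝ E] {m : ℕ}

/-- The affine parametrization of the simplex with vertices `p` over the reference simplex. -/
def simplexMap (p : Fin (m + 1) → E) (y : EuclideanSpace ℝ (Fin m)) : E := ∑ i, refCoord y i • p i

theorem simplexMap_eq_add_sum (p : Fin (m + 1) → E) (y : EuclideanSpace ℝ (Fin m)) :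
    simplexMap p y = p 0 + ∑ i : Fin m, y i • (p i.succ - p 0) := by
  simp only [simplexMap, Fin.sum_univ_succ, refCoord_zero, refCoord_succ, sub_smul, one_smul,
    smul_sub, Finset.sum_sub_distrib, Finset.sum_smul]
  abel

theorem exists_lipschitzWith_simplexMap (p : Fin (m + 1) → E) :
    ∃ K, LipschitzWith K (simplexMap p) := by
  refine ⟨∑ i : Fin m, ‖p i.succ - p 0‖₊, LipschitzWith.of_dist_le_mul fun x y => ?_⟩
  rw [dist_eq_norm, dist_eq_norm, simplexMap_eq_add_sum, simplexMap_eq_add_sum,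
    add_sub_add_left_eq_sub, ← Finset.sum_sub_distrib, NNReal.coe_sum, Finset.sum_mul]
  refine norm_sum_le_of_le _ fun i _ => ?_
  rw [← sub_smul, norm_smul, mul_comm, coe_nnnorm]
  gcongr
  exact PiLp.norm_apply_le (x - y) i

theorem apply_simplexMap {F : Type*} [NormedAddCommGroup F] [NormedSpace ℝ F] (f : E →ᵃ[ℝ] F)
    (p : Fin (m + 1) → E) (y : EuclideanSpace ℝ (Fin m)) :
    f (simplexMap p y) = simplexMap (f ∘ p) y := by
  rw [simplexMap, ← Finset.affineCombination_eq_linear_combination _ _ _ (sum_refCoord y),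
    Finset.map_affineCombination _ _ _ (sum_refCoord y),
    Finset.affineCombination_eq_linear_combination _ _ _ (sum_refCoord y), simplexMap]

theorem image_simplexMap (p : Fin (m + 1) → E) :
    simplexMap p '' {y | ∀ i, 0 ≤ refCoord y i} = convexHull ℝ (Set.range p) := by
  refine Set.Subset.antisymm ?_ fun x hx => ?_
  · rintro _ ⟨y, hy, rfl⟩
    exact (convex_convexHull ℝ _).sum_mem (fun i _ => hy i) (sum_refCoord y)
      fun i _ => subset_convexHull ℝ _ ⟨i, rfl⟩
  · have hrange : Set.range p =
        Fintype.linearCombination ℝ p '' Set.range fun i => Pi.single i (1 : ℝ) := by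
      rw [← Set.range_comp]
      exact congrArg Set.range (funext fun i => by simp)
    rw [hrange, ← LinearMap.image_convexHull, convexHull_rangle_single_eq_stdSimplex] at hx
    obtain ⟨w, ⟨hw0, hw1⟩, rfl⟩ := hx
    obtain ⟨y, rfl⟩ := exists_refCoord_eq hw1
    exact ⟨y, hw0, (Fintype.linearCombination_apply ℝ p _).symm⟩

theorem euclideanHausdorffMeasure_convexHull_range_ne_top [MeasurableSpace E] [BorelSpace E]
    (p : Fin (m + 1) → E) : μHE[m] (convexHull ℝ (Set.range p)) ≠ ⊤ := by
  obtain ⟨K, hK⟩ := exists_lipschitzWith_simplexMap p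
  have hsub : convexHull ℝ (Set.range p) ⊆ simplexMap p '' Metric.closedBall 0 1 := by
    rw [← image_simplexMap]
    exact Set.image_mono fun y hy =>
      mem_closedBall_zero_iff.2 (norm_le_one_of_refCoord_nonneg hy)
  refine ((measure_mono hsub).trans
    (euclideanHausdorffMeasure_image_le_of_lipschitzWith hK m _)).trans_lt ?_ |>.ne
  rw [EuclideanSpace.euclideanHausdorffMeasure_eq_volume]
  exact ENNReal.mul_lt_top (ENNReal.pow_lt_top ENNReal.coe_lt_top) measure_closedBall_lt_top

end SimplexMap

namespace Triangulation

variable {d m k : ℕ} {Ω : Set (EuclideanSpace ℝ (Fin d))} {T : Triangulation d Ω}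
  {s t : Finset (EuclideanSpace ℝ (Fin d))} {c : EuclideanSpace ℝ (Fin d)} {r : ℝ}

local notation "𝔼" => EuclideanSpace ℝ (Fin d)

/-- The affine parametrization of an `m`-dimensional simplex over the reference simplex, with
vertices numbered by `e`. -/
def faceMap (e : Fin (m + 1) ≃ t) : EuclideanSpace ℝ (Fin m) → 𝔼 := simplexMap fun i => (e i : 𝔼)

theorem range_coe_equiv (e : Fin (m + 1) ≃ t) : Set.range (fun i => (e i : 𝔼)) = (t : Set 𝔼) := by
  rw [← Function.comp_def, e.surjective.range_comp]
  exact Subtype.range_coe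

theorem image_faceMap (e : Fin (m + 1) ≃ t) :
    faceMap e '' {y | ∀ i, 0 ≤ refCoord y i} = convexHull ℝ (t : Set 𝔼) := by
  rw [faceMap, image_simplexMap, range_coe_equiv]

theorem coord_faceMap (hs : s ∈ T.cells) (hts : t ⊆ s) (e : Fin (m + 1) ≃ t)
    (y : EuclideanSpace ℝ (Fin m)) (i : Fin (m + 1)) :
    (cellBasis hs).coord ⟨e i, hts (e i).2⟩ (faceMap e y) = refCoord y i := by
  classical
  have hvertex : ∀ j, (cellBasis hs).coord ⟨e i, hts (e i).2⟩ (e j : 𝔼) = if i = j then 1 else 0 :=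
    fun j => by
      refine ((cellBasis hs).coord_apply _ ⟨e j, hts (e j).2⟩).trans ?_
      simp only [Subtype.mk.injEq, Subtype.coe_inj, e.apply_eq_iff_eq]
  rw [faceMap, apply_simplexMap, simplexMap]
  simp [hvertex]

theorem antilipschitzWith_faceMap (hs : s ∈ T.cells) (hts : t ⊆ s) (hr : 0 < r)
    (hc : Metric.closedBall c r ⊆ convexHull ℝ (s : Set 𝔼)) (e : Fin (m + 1) ≃ t) :
    AntilipschitzWith (m / r).toNNReal (faceMap e) := by
  refine AntilipschitzWith.of_le_mul_dist fun x y => ?_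
  rw [Real.coe_toNNReal _ (by positivity), dist_eq_norm, dist_eq_norm]
  have hcoord : ∀ i : Fin m, |(x - y) i| ≤ ‖faceMap e x - faceMap e y‖ / r := fun i => by
    have h := abs_affineMap_sub_le_div ((cellBasis hs).coord ⟨e i.succ, hts (e i.succ).2⟩) hr
      (fun z hz => bary_eq_coord hs (hc hz) _ ▸ T.bary_mem_Icc z _) (faceMap e x) (faceMap e y)
    rwa [coord_faceMap hs hts, coord_faceMap hs hts] at h
  calc ‖x - y‖ ≤ ∑ i, |(x - y) i| := norm_le_sum_abs _
    _ ≤ ∑ _i : Fin m, ‖faceMap e x - faceMap e y‖ / r := Finset.sum_le_sum fun i _ => hcoord i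
    _ = m / r * ‖faceMap e x - faceMap e y‖ := by
      rw [Finset.sum_const, Finset.card_univ, Fintype.card_fin, nsmul_eq_mul]
      ring

theorem measurableEmbedding_faceMap (hs : s ∈ T.cells) (hts : t ⊆ s) (hr : 0 < r)
    (hc : Metric.closedBall c r ⊆ convexHull ℝ (s : Set 𝔼)) (e : Fin (m + 1) ≃ t) :
    MeasurableEmbedding (faceMap e) := by
  obtain ⟨K, hK⟩ := exists_lipschitzWith_simplexMap fun i => (e i : 𝔼)
  exact ((antilipschitzWith_faceMap hs hts hr hc e).isClosedEmbedding
    hK.uniformContinuous).measurableEmbedding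

theorem bary_faceMap (ht : t ∈ T.faces) (e : Fin (m + 1) ≃ t) {y : EuclideanSpace ℝ (Fin m)}
    (hy : ∀ i, 0 ≤ refCoord y i) (i : Fin (m + 1)) :
    T.bary (faceMap e y) (e i) = refCoord y i := by
  obtain ⟨s, hs, hts⟩ := exists_cell_superset ht
  have hmem : faceMap e y ∈ convexHull ℝ (s : Set 𝔼) :=
    convexHull_mono (Finset.coe_subset.2 hts) (image_faceMap e ▸ ⟨y, hy, rfl⟩)
  rw [← coord_faceMap hs hts e y i, ← bary_eq_coord hs hmem]

/-- The relative interior of a simplex of the triangulation. -/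
def openFace (T : Triangulation d Ω) (t : Finset 𝔼) : Set 𝔼 :=
  {x ∈ convexHull ℝ (t : Set 𝔼) | (T.bary x).support = t}

theorem image_refSimplex (ht : t ∈ T.faces) (e : Fin (m + 1) ≃ t) :
    faceMap e '' refSimplex m = T.openFace t := by
  refine Set.Subset.antisymm ?_ fun x ⟨hx, hxt⟩ => ?_
  · rintro _ ⟨y, hy, rfl⟩
    have hy0 : ∀ i, 0 ≤ refCoord y i := fun i => (hy i).le
    have hmem : faceMap e y ∈ convexHull ℝ (t : Set 𝔼) := image_faceMap e ▸ ⟨y, hy0, rfl⟩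
    refine ⟨hmem, (bary_support_subset ht hmem).antisymm fun v hv => ?_⟩
    obtain ⟨i, hi⟩ := e.surjective ⟨v, hv⟩
    obtain rfl : (e i : 𝔼) = v := congrArg Subtype.val hi
    rw [Finsupp.mem_support_iff, bary_faceMap ht e hy0]
    exact (hy i).ne'
  · rw [← image_faceMap e] at hx
    obtain ⟨y, hy, rfl⟩ := hx
    refine ⟨y, fun i => (hy i).lt_of_ne' ?_, rfl⟩
    rw [← bary_faceMap ht e hy]
    exact Finsupp.mem_support_iff.1 (hxt.ge (e i).2)

theorem pairwiseDisjoint_openFace (T : Triangulation d Ω) (B : Set (Finset 𝔼)) :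
    B.PairwiseDisjoint T.openFace := fun _ _ _ _ hne =>
  Set.disjoint_left.2 fun _ hx hx' => hne (hx.2.symm.trans hx'.2)

theorem exists_closedBall_subset_cell (hs : s ∈ T.cells) :
    ∃ c, ∃ r > 0, Metric.closedBall c r ⊆ convexHull ℝ (s : Set 𝔼) := by
  have hne : (interior (convexHull ℝ (s : Set 𝔼))).Nonempty := by
    rw [← range_cellBasis hs]
    exact ⟨_, (cellBasis hs).centroid_mem_interior_convexHull⟩
  obtain ⟨c, hc⟩ := hne
  obtain ⟨r, hr, hball⟩ := Metric.nhds_basis_closedBall.mem_iff.1 (mem_interior_iff_mem_nhds.1 hc)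
  exact ⟨c, r, hr, hball⟩

theorem measurableSet_openFace (ht : t ∈ T.faces) : MeasurableSet (T.openFace t) := by
  obtain ⟨m, hm⟩ := Nat.exists_eq_succ_of_ne_zero (T.nonempty_of_mem_faces ht).card_ne_zero
  have e : Fin (m + 1) ≃ t := (t.equivFinOfCardEq hm).symm
  obtain ⟨s, hs, hts⟩ := exists_cell_superset ht
  obtain ⟨c, r, hr, hc⟩ := exists_closedBall_subset_cell hs
  rw [← image_refSimplex ht e]
  exact (measurableEmbedding_faceMap hs hts hr hc e).measurableSet_image.2
    (isOpen_refSimplex m).measurableSet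

/-- The node of the reference simplex that corresponds to a Lagrange node on a face. -/
def Node.refIndex (e : Fin (m + 1) ≃ t) (a : {a : T.Node k // a.1.support ⊆ t}) : RefIndex m k :=
  ⟨fun i => a.1.1 (e i), Finset.mem_finAntidiagonal.2 <| by
    rw [e.sum_comp fun v : t => a.1.1 v, Finset.sum_coe_sort t a.1.1]
    exact (Finsupp.sum_of_support_subset _ a.2 _ fun _ _ => rfl).symm.trans a.1.2.2⟩

theorem Node.refIndex_injective (e : Fin (m + 1) ≃ t) :
    Function.Injective (Node.refIndex (T := T) (k := k) e) := by
  intro a b hab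
  refine Subtype.ext (Subtype.ext (Finsupp.ext fun v => ?_))
  by_cases hv : v ∈ t
  · obtain ⟨i, hi⟩ := e.surjective ⟨v, hv⟩
    obtain rfl : (e i : 𝔼) = v := congrArg Subtype.val hi
    exact congrFun (congrArg Subtype.val hab) i
  · rw [Finsupp.notMem_support_iff.1 fun h => hv (a.2 h),
      Finsupp.notMem_support_iff.1 fun h => hv (b.2 h)]

theorem nodalBasis_faceMap (ht : t ∈ T.faces) (e : Fin (m + 1) ≃ t)
    {y : EuclideanSpace ℝ (Fin m)} (hy : ∀ i, 0 ≤ refCoord y i)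
    (a : {a : T.Node k // a.1.support ⊆ t}) :
    T.nodalBasis k a.1 (faceMap e y) = refShape (Node.refIndex e a) y := by
  rw [nodalBasis_eq_prod_nodalFactor, Finset.prod_subset
    (f := fun v => nodalFactor k (a.1.1 v) (T.bary (faceMap e y) v)) a.2 fun v _ hv => by
      simp [Finsupp.notMem_support_iff.1 hv, nodalFactor]]
  rw [← Finset.prod_coe_sort, ← e.prod_comp, refShape]
  refine Finset.prod_congr rfl fun i _ => ?_
  rw [bary_faceMap ht e hy]
  rfl

/-- The finite element function with coefficient vector `u`. -/
def femFunction (u : T.Node k → ℝ) (x : 𝔼) : ℝ := ∑ a, u a * T.nodalBasis k a x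

open Classical in
theorem femFunction_faceMap (ht : t ∈ T.faces) (e : Fin (m + 1) ≃ t)
    {y : EuclideanSpace ℝ (Fin m)} (hy : ∀ i, 0 ≤ refCoord y i) (u : T.Node k → ℝ) :
    femFunction u (faceMap e y) =
      ∑ a : {a : T.Node k // a.1.support ⊆ t}, u a.1 * refShape (Node.refIndex e a) y := by
  have hmem : faceMap e y ∈ convexHull ℝ (t : Set 𝔼) := image_faceMap e ▸ ⟨y, hy, rfl⟩
  refine (Fintype.sum_of_injective Subtype.val Subtype.val_injective _ _ (fun a ha => ?_)
    fun a => by rw [nodalBasis_faceMap ht e hy]).symm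
  by_contra h
  exact ha ⟨⟨a, support_subset_of_nodalBasis_ne_zero ht hmem (right_ne_zero_of_mul h)⟩, rfl⟩

open Classical in
theorem exists_sum_sq_le_setIntegral_openFace (m : ℕ) (hk : 1 ≤ k) :
    ∃ C : ℝ, 0 ≤ C ∧ ∀ {d : ℕ} {Ω : Set (EuclideanSpace ℝ (Fin d))} {T : Triangulation d Ω}
      {s t : Finset (EuclideanSpace ℝ (Fin d))} {c : EuclideanSpace ℝ (Fin d)} {r : ℝ}
      (u : T.Node k → ℝ), s ∈ T.cells → t ∈ T.faces → t ⊆ s → t.card = m + 1 → 0 < r →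
      Metric.closedBall c r ⊆ convexHull ℝ (s : Set (EuclideanSpace ℝ (Fin d))) →
      IntegrableOn (fun x => femFunction u x ^ 2) (T.openFace t) μHE[m] →
      ∑ a with a.1.support ⊆ t, u a ^ 2 ≤
        C * ((m / r) ^ m * ∫ x in T.openFace t, femFunction u x ^ 2 ∂μHE[m]) := by
  obtain ⟨C, hC0, hC⟩ := exists_sum_sq_le_integral_refShape_comp m hk
  refine ⟨C, hC0, fun {d Ω T s t c r} u hs ht hts hm hr hc hu => ?_⟩
  have e : Fin (m + 1) ≃ t := (t.equivFinOfCardEq hm).symm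
  rw [← image_refSimplex ht e] at hu ⊢
  have hparam := setIntegral_comp_le_of_antilipschitzWith
    (antilipschitzWith_faceMap hs hts hr hc e) (measurableEmbedding_faceMap hs hts hr hc e)
    (fun x => sq_nonneg (femFunction u x)) hu
  rw [EuclideanSpace.euclideanHausdorffMeasure_eq_volume,
    Real.coe_toNNReal _ (by positivity)] at hparam
  calc ∑ a with a.1.support ⊆ t, u a ^ 2 = ∑ a : {a : T.Node k // a.1.support ⊆ t}, u a.1 ^ 2 :=
        Finset.sum_subtype _ (by simp) _
    _ ≤ C * ∫ y in refSimplex m, (∑ a : {a : T.Node k // a.1.support ⊆ t},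
          u a.1 * refShape (Node.refIndex e a) y) ^ 2 :=
        hC (Node.refIndex_injective e) _
    _ = C * ∫ y in refSimplex m, femFunction u (faceMap e y) ^ 2 := by
        congr 1
        refine setIntegral_congr_fun (isOpen_refSimplex m).measurableSet fun y hy => ?_
        rw [femFunction_faceMap ht e fun i => (hy i).le]
    _ ≤ _ := by gcongr

end Triangulation

namespace Triangulation

variable {d k : ℕ} {Ω : Set (EuclideanSpace ℝ (Fin d))} {T : Triangulation d Ω}
  {t : Finset (EuclideanSpace ℝ (Fin d))}

local notation "𝔼" => EuclideanSpace ℝ (Fin d)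

theorem euclideanHausdorffMeasure_convexHull_face_ne_top (ht : t ∈ T.faces) :
    μHE[t.card - 1] (convexHull ℝ (t : Set 𝔼)) ≠ ⊤ := by
  obtain ⟨m, hm⟩ := Nat.exists_eq_succ_of_ne_zero (T.nonempty_of_mem_faces ht).card_ne_zero
  rw [hm, ← range_coe_equiv (t.equivFinOfCardEq hm).symm]
  exact euclideanHausdorffMeasure_convexHull_range_ne_top _

open Classical in
/-- The faces of dimension `d - 1` that make up the boundary `Γ = ∂Ω`. -/
def boundaryFacets (T : Triangulation d Ω) : Finset (Finset 𝔼) :=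
  {t ∈ T.finite_faces.toFinset | t.card = d ∧ convexHull ℝ (t : Set 𝔼) ⊆ frontier Ω}

theorem mem_boundaryFacets :
    t ∈ T.boundaryFacets ↔ t ∈ T.faces ∧ t.card = d ∧ convexHull ℝ (t : Set 𝔼) ⊆ frontier Ω := by
  simp [boundaryFacets]

theorem exists_boundaryFacet_of_mem_frontier (T : Triangulation d Ω)
    (hΩ : interior (closure Ω) = Ω) {x : 𝔼} (hx : x ∈ frontier Ω) :
    ∃ t ∈ T.boundaryFacets, x ∈ convexHull ℝ (t : Set 𝔼) := by
  obtain ⟨t, ht, hcard, hxt, hfr⟩ := T.exists_facet_of_mem_frontier hΩ hx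
  exact ⟨t, mem_boundaryFacets.2 ⟨ht, hcard, hfr⟩, hxt⟩

theorem euclideanHausdorffMeasure_frontier_ne_top (T : Triangulation d Ω)
    (hΩ : interior (closure Ω) = Ω) : μHE[d - 1] (frontier Ω) ≠ ⊤ := by
  have hcover : frontier Ω ⊆ ⋃ t ∈ T.boundaryFacets, convexHull ℝ (t : Set 𝔼) := fun x hx => by
    simpa using T.exists_boundaryFacet_of_mem_frontier hΩ hx
  refine ((measure_mono hcover).trans_lt ?_).ne
  refine measure_biUnion_lt_top T.boundaryFacets.finite_toSet fun t ht => ?_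
  obtain ⟨ht, hcard, -⟩ := mem_boundaryFacets.1 ht
  simpa only [hcard] using (euclideanHausdorffMeasure_convexHull_face_ne_top ht).lt_top

theorem memLp_surfaceMeasure_of_mem_lagrangeSpace (hΩ : interior (closure Ω) = Ω) {v : 𝔼 → ℝ}
    (hv : v ∈ T.lagrangeSpace k) {p : ENNReal} : MemLp v p (surfaceMeasure Ω) :=
  memLp_restrict_of_isCompact
    (T.isCompact_closure.of_isClosed_subset isClosed_frontier frontier_subset_closure)
    isClosed_frontier.measurableSet (T.euclideanHausdorffMeasure_frontier_ne_top hΩ)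
    (hv.1.mono frontier_subset_closure)

theorem femFunction_mem_lagrangeSpace (u : T.Node k → ℝ) : femFunction u ∈ T.lagrangeSpace k := by
  have hsum : femFunction u = ∑ a, u a • T.nodalBasis k a := by
    funext x
    simp [femFunction, Finset.sum_apply]
  rw [hsum]
  exact Submodule.sum_mem _ fun a _ => Submodule.smul_mem _ _ (nodalBasis_mem a)

theorem sum_setIntegral_openFace_le {g : 𝔼 → ℝ} (hg : ∀ x, 0 ≤ g x)
    (hint : Integrable g (surfaceMeasure Ω)) :
    ∑ t ∈ T.boundaryFacets, ∫ x in T.openFace t, g x ∂μHE[d - 1] ≤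
      ∫ x, g x ∂(surfaceMeasure Ω) := by
  have hsub : ∀ t ∈ T.boundaryFacets, T.openFace t ⊆ frontier Ω := fun t ht x hx =>
    (mem_boundaryFacets.1 ht).2.2 hx.1
  rw [← integral_biUnion_finset T.boundaryFacets
    (fun t ht => measurableSet_openFace (mem_boundaryFacets.1 ht).1)
    (T.pairwiseDisjoint_openFace _) fun t ht => IntegrableOn.mono_set hint (hsub t ht)]
  exact setIntegral_mono_set hint (Eventually.of_forall hg)
    (LE.le.eventuallyLE (Set.iUnion₂_subset hsub))

open Classical in
theorem sum_sq_boundaryPart_le (hk : 1 ≤ k) (hΩ : interior (closure Ω) = Ω) (u : T.Node k → ℝ) :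
    ∑ a, boundaryPart u a ^ 2 ≤
      ∑ t ∈ T.boundaryFacets, ∑ a with a.1.support ⊆ t, u a ^ 2 := by
  have hfacet : ∀ a : T.BoundaryNode k, ∃ t ∈ T.boundaryFacets, a.1.1.support ⊆ t := fun a => by
    obtain ⟨t, ht, hat⟩ := T.exists_boundaryFacet_of_mem_frontier hΩ a.2
    exact ⟨t, ht, a.1.support_subset hk (mem_boundaryFacets.1 ht).1 hat⟩
  choose F hF hsupp using hfacet
  calc ∑ a, boundaryPart u a ^ 2 = ∑ t ∈ T.boundaryFacets, ∑ a with F a = t, u a.1 ^ 2 :=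
        (Finset.sum_fiberwise_of_maps_to (fun a _ => hF a) _).symm
    _ ≤ ∑ t ∈ T.boundaryFacets, ∑ a with a.1.support ⊆ t, u a ^ 2 := by
        gcongr with t
        rw [← Finset.sum_image (f := fun a => u a ^ 2) (g := fun a : T.BoundaryNode k => a.1)
          fun _ _ _ _ h => Subtype.ext h]
        refine Finset.sum_le_sum_of_subset_of_nonneg ?_ fun _ _ _ => sq_nonneg _
        simp only [Finset.subset_iff, Finset.mem_image, Finset.mem_filter_univ]
        rintro _ ⟨a, rfl, rfl⟩
        exact hsupp a

theorem exists_sum_sq_boundaryPart_le (m : ℕ) (hk : 1 ≤ k) :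
    ∃ C : ℝ, 0 ≤ C ∧ ∀ {Ω : Set (EuclideanSpace ℝ (Fin (m + 1)))} (_ : interior (closure Ω) = Ω)
      {T : Triangulation (m + 1) Ω} {κ : ℝ} (_ : 0 < κ) (_ : T.QuasiUniform κ) (u : T.Node k → ℝ),
      ∑ a, boundaryPart u a ^ 2 ≤
        C * ((m / (T.meshWidth / κ)) ^ m * ∫ x, femFunction u x ^ 2 ∂(surfaceMeasure Ω)) := by
  classical
  obtain ⟨C, hC0, hC⟩ := exists_sum_sq_le_setIntegral_openFace m hk
  refine ⟨C, hC0, fun {Ω} hΩ {T κ} hκ hT u => ?_⟩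
  have hint : Integrable (fun x => femFunction u x ^ 2) (surfaceMeasure Ω) :=
    (memLp_surfaceMeasure_of_mem_lagrangeSpace hΩ (femFunction_mem_lagrangeSpace u)).integrable_sq
  have hr : 0 ≤ T.meshWidth / κ := div_nonneg T.meshWidth_nonneg hκ.le
  have hfacet : ∀ t ∈ T.boundaryFacets, ∑ a with a.1.support ⊆ t, u a ^ 2 ≤
      C * ((m / (T.meshWidth / κ)) ^ m * ∫ x in T.openFace t, femFunction u x ^ 2 ∂μHE[m]) := by
    intro t ht
    obtain ⟨ht, hcard, hfr⟩ := mem_boundaryFacets.1 ht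
    obtain ⟨s, hs, hts⟩ := exists_cell_superset ht
    obtain ⟨c, hc⟩ := hT s hs
    exact hC u hs ht hts hcard (div_pos (meshWidth_pos m.succ_ne_zero hs) hκ) hc
      (IntegrableOn.mono_set hint fun x hx => hfr hx.1)
  calc ∑ a, boundaryPart u a ^ 2
      ≤ ∑ t ∈ T.boundaryFacets, ∑ a with a.1.support ⊆ t, u a ^ 2 := sum_sq_boundaryPart_le hk hΩ u
    _ ≤ ∑ t ∈ T.boundaryFacets, C * ((m / (T.meshWidth / κ)) ^ m *
          ∫ x in T.openFace t, femFunction u x ^ 2 ∂μHE[m]) := Finset.sum_le_sum hfacet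
    _ = C * ((m / (T.meshWidth / κ)) ^ m *
          ∑ t ∈ T.boundaryFacets, ∫ x in T.openFace t, femFunction u x ^ 2 ∂μHE[m]) := by
        rw [Finset.mul_sum, Finset.mul_sum]
    _ ≤ _ := by
        gcongr
        exact sum_setIntegral_openFace_le (fun x => sq_nonneg _) hint

end Triangulation

theorem integral_sq_le_of_integral_sq_eq_integral_mul {X : Type*} [MeasurableSpace X]
    {ν : Measure X} {v w : X → ℝ} (hv : MemLp v 2 ν) (hw : MemLp w 2 ν)
    (h : ∫ x, v x ^ 2 ∂ν = ∫ x, v x * w x ∂ν) : ∫ x, v x ^ 2 ∂ν ≤ ∫ x, w x ^ 2 ∂ν := by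
  have hmono : ∫ x, 2 * (v x * w x) ∂ν ≤ ∫ x, (v x ^ 2 + w x ^ 2) ∂ν :=
    integral_mono ((hv.integrable_mul hw).const_mul 2) (hv.integrable_sq.add hw.integrable_sq)
      fun x => (mul_assoc 2 (v x) (w x)).symm.trans_le (two_mul_le_add_sq (v x) (w x))
  rw [integral_const_mul, integral_add hv.integrable_sq hw.integrable_sq] at hmono
  linarith

section Projection

variable {d : ℕ} {Ω : Set (EuclideanSpace ℝ (Fin d))} {ι ι' κ : Type*} [Fintype ι] [Fintype ι']
  [Fintype κ] {μ : ι → EuclideanSpace ℝ (Fin d) → ℝ} {φ : κ → EuclideanSpace ℝ (Fin d) → ℝ}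
  {ψ : ι' → EuclideanSpace ℝ (Fin d) → ℝ}

/-- Testing with the `μ_i` expresses that `∑ u_a φ_a`, which lies in their span, is the
`L²(Γ)`-projection of `∑ p_j ψ_j`. -/
theorem integral_sum_sq_le_normSq_of_mulVec_eq (hμ : ∀ i, MemLp (μ i) 2 (surfaceMeasure Ω))
    (hφ : ∀ a, MemLp (φ a) 2 (surfaceMeasure Ω)) (hψ : ∀ j, MemLp (ψ j) 2 (surfaceMeasure Ω))
    {u : κ → ℝ} {p : ι' → ℝ} {c : ι → ℝ}
    (hc : ∀ᵐ x ∂(surfaceMeasure Ω), ∑ a, u a * φ a x = ∑ i, c i * μ i x)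
    (hup : (surfaceMatrix Ω μ φ).mulVec u = (surfaceMatrix Ω μ ψ).mulVec p) :
    ∫ x, (∑ a, u a * φ a x) ^ 2 ∂(surfaceMeasure Ω) ≤ normSq (surfaceMatrix Ω ψ ψ) p := by
  have hnorm : normSq (surfaceMatrix Ω ψ ψ) p =
      ∫ x, (∑ j, p j * ψ j x) ^ 2 ∂(surfaceMeasure Ω) := by
    simp only [sq, integral_sum_mul_sum hψ hψ]
    rfl
  rw [hnorm]
  refine integral_sq_le_of_integral_sq_eq_integral_mul
    (memLp_finsetSum _ fun a _ => (hφ a).const_mul (u a))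
    (memLp_finsetSum _ fun j _ => (hψ j).const_mul (p j)) ?_
  calc ∫ x, (∑ a, u a * φ a x) ^ 2 ∂(surfaceMeasure Ω)
      = ∫ x, (∑ i, c i * μ i x) * ∑ a, u a * φ a x ∂(surfaceMeasure Ω) :=
        integral_congr_ae (hc.mono fun x hx => by simp only [sq, hx])
    _ = ∫ x, (∑ i, c i * μ i x) * ∑ j, p j * ψ j x ∂(surfaceMeasure Ω) := by
        rw [integral_sum_mul_sum hμ hφ, integral_sum_mul_sum hμ hψ]
        exact congrArg (c ⬝ᵥ ·) hup
    _ = ∫ x, (∑ a, u a * φ a x) * ∑ j, p j * ψ j x ∂(surfaceMeasure Ω) :=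
        integral_congr_ae (hc.mono fun x hx => by simp only [hx])

end Projection

namespace Triangulation

variable {d k : ℕ} {Ω : Set (EuclideanSpace ℝ (Fin d))} {T : Triangulation d Ω}

local notation "𝔼" => EuclideanSpace ℝ (Fin d)

theorem ae_surfaceMeasure_of_traceMap_eq {v w : 𝔼 → ℝ} (h : traceMap Ω v = traceMap Ω w) :
    v =ᵐ[surfaceMeasure Ω] w := by
  filter_upwards [ae_restrict_mem isClosed_frontier.measurableSet] with x hx
  exact congrFun h ⟨x, hx⟩

theorem memLp_surfaceMeasure_of_traceMap_mem (hΩ : interior (closure Ω) = Ω) {v : 𝔼 → ℝ}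
    (hv : traceMap Ω v ∈ (T.lagrangeSpace k).map (traceMap Ω)) {p : ENNReal} :
    MemLp v p (surfaceMeasure Ω) := by
  obtain ⟨w, hw, hwv⟩ := hv
  exact (memLp_surfaceMeasure_of_mem_lagrangeSpace hΩ hw).ae_eq
    (ae_surfaceMeasure_of_traceMap_eq hwv)

theorem integral_femFunction_sq_le_normSq {ι ι' : Type*} [Finite ι] [Fintype ι']
    (hΩ : interior (closure Ω) = Ω) {μ : ι → 𝔼 → ℝ} (hμ : ∀ i, MemLp (μ i) 2 (surfaceMeasure Ω))
    (hspan : (T.lagrangeSpace k).map (traceMap Ω) ≤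
      Submodule.span ℝ (Set.range fun i => traceMap Ω (μ i)))
    {ψ : ι' → 𝔼 → ℝ} (hψ : ∀ j, MemLp (ψ j) 2 (surfaceMeasure Ω)) {u : T.Node k → ℝ} {p : ι' → ℝ}
    (hup : (surfaceMatrix Ω μ (T.nodalBasis k)).mulVec u = (surfaceMatrix Ω μ ψ).mulVec p) :
    ∫ x, femFunction u x ^ 2 ∂(surfaceMeasure Ω) ≤ normSq (surfaceMatrix Ω ψ ψ) p := by
  have := Fintype.ofFinite ι
  obtain ⟨c, hc⟩ := Submodule.mem_span_range_iff_exists_fun ℝ |>.1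
    (hspan (Submodule.mem_map_of_mem (femFunction_mem_lagrangeSpace u)))
  have htrace : traceMap Ω (femFunction u) = traceMap Ω fun x => ∑ i, c i * μ i x := by
    rw [← hc]
    funext x
    simp [traceMap, LinearMap.funLeft_apply]
  exact integral_sum_sq_le_normSq_of_mulVec_eq hμ
    (fun a => memLp_surfaceMeasure_of_mem_lagrangeSpace hΩ (nodalBasis_mem a)) hψ
    (ae_surfaceMeasure_of_traceMap_eq htrace) hup

theorem exists_normSq_boundaryBlock_massMatrix_le (m : ℕ) {k : ℕ} (hk : 1 ≤ k) {κ : ℝ}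
    (hκ : 0 < κ) : ∃ c : ℝ, 0 ≤ c ∧ ∀ {Ω : Set (EuclideanSpace ℝ (Fin (m + 1)))}
      (_ : interior (closure Ω) = Ω) {T : Triangulation (m + 1) Ω} (_ : T.QuasiUniform κ)
      (u : T.Node k → ℝ), normSq (boundaryBlock (T.massMatrix k)) (boundaryPart u) ≤
        c * T.meshWidth * ∫ x, femFunction u x ^ 2 ∂(surfaceMeasure Ω) := by
  obtain ⟨C, hC0, hC⟩ := exists_sum_sq_boundaryPart_le m hk
  set N : ℝ := ((k : ℝ) + 1) ^ (m + 1 + 1)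
  set V : ℝ := volume.real (Metric.ball (0 : EuclideanSpace ℝ (Fin (m + 1))) 1)
  refine ⟨N * nodalBound k ^ 2 * V * C * (m * κ) ^ m, by positivity, fun {Ω} hΩ {T} hT u => ?_⟩
  have hh := T.meshWidth_nonneg
  set I := ∫ x, femFunction u x ^ 2 ∂(surfaceMeasure Ω)
  set h := T.meshWidth
  have hscale : h ^ (m + 1) * (m / (h / κ)) ^ m = (m * κ) ^ m * h := by
    rcases eq_or_ne h 0 with h0 | h0
    · simp [h0]
    · rw [div_div_eq_mul_div, div_pow]
      field_simp
      ring
  calc normSq (boundaryBlock (T.massMatrix k)) (boundaryPart u)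
      ≤ N * (nodalBound k ^ 2 * (h ^ (m + 1) * V)) * ∑ a, boundaryPart u a ^ 2 :=
        normSq_submatrix_le (e := fun a : T.BoundaryNode k => a.1) (normSq_massMatrix_le hk)
          (fun _ _ => Subtype.ext) _
    _ ≤ N * (nodalBound k ^ 2 * (h ^ (m + 1) * V)) * (C * ((m / (h / κ)) ^ m * I)) := by
        gcongr
        exact hC hΩ hκ hT u
    _ = N * nodalBound k ^ 2 * V * C * (h ^ (m + 1) * (m / (h / κ)) ^ m) * I := by ring
    _ = N * nodalBound k ^ 2 * V * C * (m * κ) ^ m * h * I := by rw [hscale]; ring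

theorem exists_normSq_boundaryBlock_stiffnessMatrix_le (m : ℕ) {k : ℕ} (hk : 1 ≤ k) {κ : ℝ}
    (hκ : 0 < κ) : ∃ c : ℝ, 0 ≤ c ∧ ∀ {Ω : Set (EuclideanSpace ℝ (Fin (m + 1)))}
      (_ : interior (closure Ω) = Ω) {T : Triangulation (m + 1) Ω} (_ : T.QuasiUniform κ)
      {α : EuclideanSpace ℝ (Fin (m + 1)) → ℝ} {A : ℝ} (_ : 0 ≤ A)
      (_ : AEStronglyMeasurable α (volume.restrict Ω))
      (_ : ∀ᵐ x ∂(volume.restrict Ω), |α x| ≤ A) (u : T.Node k → ℝ),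
      normSq (boundaryBlock (T.stiffnessMatrix k α)) (boundaryPart u) ≤
        c * A * T.meshWidth⁻¹ * ∫ x, femFunction u x ^ 2 ∂(surfaceMeasure Ω) := by
  obtain ⟨C, hC0, hC⟩ := exists_sum_sq_boundaryPart_le m hk
  set N : ℝ := ((k : ℝ) + 1) ^ (m + 1 + 1)
  set V : ℝ := volume.real (Metric.ball (0 : EuclideanSpace ℝ (Fin (m + 1))) 1)
  refine ⟨N * (nodalLipBound k * κ) ^ 2 * V * C * (m * κ) ^ m, by positivity,
    fun {Ω} hΩ {T} hT {α A} hA hα hαA u => ?_⟩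
  have hh := T.meshWidth_nonneg
  set I := ∫ x, femFunction u x ^ 2 ∂(surfaceMeasure Ω)
  set h := T.meshWidth
  have hscale : (nodalLipBound k / (h / κ)) ^ 2 * h ^ (m + 1) * (m / (h / κ)) ^ m =
      (nodalLipBound k * κ) ^ 2 * (m * κ) ^ m * h⁻¹ := by
    rcases eq_or_ne h 0 with h0 | h0
    · simp [h0]
    · rw [div_div_eq_mul_div, div_div_eq_mul_div, div_pow, div_pow]
      field_simp
      ring
  calc normSq (boundaryBlock (T.stiffnessMatrix k α)) (boundaryPart u)
      ≤ A * N * ((nodalLipBound k / (h / κ)) ^ 2 * (h ^ (m + 1) * V)) *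
          ∑ a, boundaryPart u a ^ 2 :=
        normSq_submatrix_le (e := fun a : T.BoundaryNode k => a.1)
          (normSq_stiffnessMatrix_le m.succ_ne_zero hk hκ hT hA hα hαA) (fun _ _ => Subtype.ext) _
    _ ≤ A * N * ((nodalLipBound k / (h / κ)) ^ 2 * (h ^ (m + 1) * V)) *
          (C * ((m / (h / κ)) ^ m * I)) := by
        gcongr
        exact hC hΩ hκ hT u
    _ = A * N * V * C *
          ((nodalLipBound k / (h / κ)) ^ 2 * h ^ (m + 1) * (m / (h / κ)) ^ m) * I := by ring
    _ = N * (nodalLipBound k * κ) ^ 2 * V * C * (m * κ) ^ m * A * h⁻¹ * I := by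
        rw [hscale]
        ring

end Triangulation

end BulkSurface

end

open BulkSurface BulkSurface.Triangulation in
theorem mainTheorem6_general (D k : ℕ) (hk : 1 ≤ k) (κ : ℝ) (hκ : 0 < κ) :
    ∃ c : ℝ, 0 < c ∧ ∀ (d : ℕ) (_ : 1 ≤ d) (_ : d ≤ D)
      (Ω : Set (EuclideanSpace ℝ (Fin d))) (_ : interior (closure Ω) = Ω)
      (T : Triangulation d Ω) (_ : T.QuasiUniform κ)
      (α : EuclideanSpace ℝ (Fin d) → ℝ) (_ : AEStronglyMeasurable α (volume.restrict Ω))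
      (A : ℝ) (_ : 0 ≤ A) (_ : ∀ᵐ x ∂(volume.restrict Ω), |α x| ≤ A)
      (Nl Np : ℕ)
      (μ : Fin Nl → EuclideanSpace ℝ (Fin d) → ℝ)
      (_ : ∀ i, MemLp (μ i) 2 (surfaceMeasure Ω))
      (_ : (T.lagrangeSpace k).map (traceMap Ω) ≤
        Submodule.span ℝ (Set.range fun i => traceMap Ω (μ i)))
      (ψ : Fin Np → EuclideanSpace ℝ (Fin d) → ℝ)
      (_ : ∀ j, MemLp (ψ j) 2 (surfaceMeasure Ω))
      (u : T.Node k → ℝ) (p : Fin Np → ℝ)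
      (_ : (surfaceMatrix Ω μ (T.nodalBasis k)).mulVec u = (surfaceMatrix Ω μ ψ).mulVec p),
      normSq (boundaryBlock (T.massMatrix k)) (boundaryPart u) ≤
          c * T.meshWidth * normSq (surfaceMatrix Ω ψ ψ) p ∧
      normSq (boundaryBlock (T.stiffnessMatrix k α)) (boundaryPart u) ≤
          c * A * T.meshWidth⁻¹ * normSq (surfaceMatrix Ω ψ ψ) p := by
  choose cM hcM0 hcM using fun m => exists_normSq_boundaryBlock_massMatrix_le m hk hκ
  choose cK hcK0 hcK using fun m => exists_normSq_boundaryBlock_stiffnessMatrix_le m hk hκ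
  have hsum : ∀ m, 0 ≤ cM m + cK m := fun m => add_nonneg (hcM0 m) (hcK0 m)
  obtain ⟨c, hc0, hc⟩ : ∃ c : ℝ, 0 < c ∧ ∀ m < D, cM m + cK m ≤ c :=
    ⟨∑ m ∈ Finset.range D, (cM m + cK m) + 1,
      add_pos_of_nonneg_of_pos (Finset.sum_nonneg fun m _ => hsum m) one_pos, fun m hm =>
      (Finset.single_le_sum (fun m _ => hsum m) (Finset.mem_range.2 hm)).trans (by simp)⟩
  refine ⟨c, hc0, ?_⟩
  intro d hd hdD Ω hΩ T hT α hα A hA hαA Nl Np μ hμ hspan ψ hψ u p hup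
  obtain ⟨m, rfl⟩ := Nat.exists_eq_succ_of_ne_zero (Nat.one_le_iff_ne_zero.1 hd)
  have hproj := integral_femFunction_sq_le_normSq hΩ hμ hspan hψ hup
  have hh := T.meshWidth_nonneg
  have hcM_le : cM m ≤ c := by linarith [hc m hdD, hcK0 m]
  have hcK_le : cK m ≤ c := by linarith [hc m hdD, hcM0 m]
  constructor
  · exact (hcM m hΩ hT u).trans (by gcongr)
  · exact (hcK m hΩ hT hA hα hαA u).trans (by gcongr)

open BulkSurface in
theorem mainTheorem6 (k : ℕ) (hk : 1 ≤ k) (κ : ℝ) (hκ : 0 < κ) :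
    ∃ c_M : ℝ, 0 < c_M ∧ ∀ A : ℝ, 0 < A → ∃ c_K : ℝ, 0 < c_K ∧
      ∀ (d : ℕ) (_ : d = 2 ∨ d = 3)
        (Ω : Set (EuclideanSpace ℝ (Fin d))) (_ : IsOpen Ω) (_ : interior (closure Ω) = Ω)
        (T : Triangulation d Ω) (_ : T.QuasiUniform κ)
        (α : EuclideanSpace ℝ (Fin d) → ℝ)
        (_ : AEStronglyMeasurable α (volume.restrict Ω))
        (_ : ∃ α₀ : ℝ, 0 < α₀ ∧ ∀ᵐ x ∂(volume.restrict Ω), α₀ ≤ α x)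
        (_ : ∀ᵐ x ∂(volume.restrict Ω), α x ≤ A)
        (Nl Np : ℕ)
        (μ : Fin Nl → EuclideanSpace ℝ (Fin d) → ℝ)
        (_ : (T.lagrangeSpace k).map (traceMap Ω) =
          Submodule.span ℝ (Set.range fun i => traceMap Ω (μ i)))
        (ψ : Fin Np → EuclideanSpace ℝ (Fin d) → ℝ)
        (_ : ∀ j, MemLp (ψ j) 2 (surfaceMeasure Ω))
        (u : T.Node k → ℝ) (p : Fin Np → ℝ)
        (_ : (surfaceMatrix Ω μ (T.nodalBasis k)).mulVec u = (surfaceMatrix Ω μ ψ).mulVec p),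
        normSq (Triangulation.boundaryBlock (T.massMatrix k)) (Triangulation.boundaryPart u) ≤
            c_M * T.meshWidth * normSq (surfaceMatrix Ω ψ ψ) p ∧
        normSq (Triangulation.boundaryBlock (T.stiffnessMatrix k α))
            (Triangulation.boundaryPart u) ≤
            c_K * T.meshWidth⁻¹ * normSq (surfaceMatrix Ω ψ ψ) p := by
  obtain ⟨c, hc, h⟩ := mainTheorem6_general 3 k hk κ hκ
  refine ⟨c, hc, fun A hA => ⟨c * A, by positivity, ?_⟩⟩
  rintro d hd Ω - hΩ T hT α hα ⟨α₀, hα₀, hα0⟩ hαA Nl Np μ hμ ψ hψ u p hup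
  have habs : ∀ᵐ x ∂(volume.restrict Ω), |α x| ≤ A := by
    filter_upwards [hα0, hαA] with x h0 hA
    rwa [abs_of_pos (hα₀.trans_le h0)]
  have hμL : ∀ i, MemLp (μ i) 2 (surfaceMeasure Ω) := fun i =>
    Triangulation.memLp_surfaceMeasure_of_traceMap_mem hΩ
      (hμ.ge (Submodule.subset_span (Set.mem_range_self i)))
  exact h d (by omega) (by omega) Ω hΩ T hT α hα A hA.le habs Nl Np μ hμL hμ.le ψ hψ u p hup
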